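/- Let $\mathbb K$ be an algebraically closed field of characteristic zero, and let $X$ be a normal affine (irreducible) variety over $\mathbb K$ with an effective regular action of an algebraic torus $T=(\mathbb K^\times)^r$ having an open orbit (so $X$ is an affine toric variety). Assume that every invertible function in $\mathbb K[X]$ is constant. Let $M=\mathfrak X(T)=\mathbb Z^r$, let $N=\mathrm{Hom}(M,\mathbb Z)$, let $\sigma\subset N_{\mathbb Q}$ be the cone of $X$, i.e. the dual of the cone in $M_{\mathbb Q}$ generated by the weights of $T$ on $\mathbb K[X]$, and let $\Delta(1)$ be the (finite) set of one-dimensional faces of $\sigma$. For $\rho\in\Delta(1)$ let $D_\rho\subset X$ be the closed $T$-stable subset whose ideal is generated by the $T$-semi-invariant functions whose weight is positive on $\rho\setminus\{0\}$; the $D_\rho$ are exactly the $T$-invariant prime divisors of $X$, each occurring for exactly one $\rho$. Let $\mathrm{Cox}(X)=\mathbb K[x_\rho:\rho\in\Delta(1)]$, graded by $\mathrm{Cl}(X)$ via $\deg x_\rho=[D_\rho]$. The divisor class group $\mathrm{Cl}(X)$ is finitely generated. Choose any decomposition $\mathrm{Cl}(X)\cong\mathbb Z^n\oplus\mathbb Z/k_1\oplus\dots\oplus\mathbb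 Z/k_s$ $(k_j\ge 1)$, with standard generators $\xi_1,\dots,\xi_n,\eta_1,\dots,\eta_s$, any divisors $E_i$, $W_j$ with $[E_i]=\xi_i$, $[W_j]=\eta_j$, and any nonzero rational functions $F_j$ with $(F_j)=k_jW_j$. With $H^0(X,D)=\{f\in\mathbb K(X): f=0\text{ or }(f)+D\ge 0\}$, let $$S(X)=\bigoplus_{\lambda_i\in\mathbb Z,\;0\le\mu_j<k_j}H^0\Bigl(X,\sum_i\lambda_iE_i+\sum_j\mu_jW_j\Bigr),$$ with the component of index $(\lambda,\mu)$ having degree $\sum\lambda_i\xi_i+\sum\mu_j\eta_j\in\mathrm{Cl}(X)$, and with the bilinear multiplication given for $f$ of index $(a,b)$ and $g$ of index $(c,d)$ by $$f*g=fg\prod_jF_j^{\lfloor (b_j+d_j)/k_j\rfloor}.$$ This is a commutative $\mathrm{Cl}(X)$-graded $\mathbb K$-algebra. Then $S(X)$ and $\mathrm{Cox}(X)$ are isomorphic as $\mathrm{Cl}(X)$-graded $\mathbb K$-algebras: there is a $\mathbb K$-algebra isomorphism mapping, for every $\alpha\in\mathrm{Cl}(X)$, the component of degree $\alpha$ of $S(X)$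 onto the component of degree $\alpha$ of $\mathrm{Cox}(X)$. In particular, $S(X)$ is a polynomial ring. -/

import Mathlib

noncomputable section

/-! ### Weil divisors on a normal affine variety

A normal affine variety `X` is given by its coordinate ring `A`.  Prime divisors are the primes of
height one, the field of rational functions is `FractionRing A`. -/

/-- A prime divisor on `Spec A`: a prime ideal of height one. -/
@[ext]
structure PrimeDivisor (A : Type*) [CommRing A] extends PrimeSpectrum A where
  height_eq : asIdeal.height = 1

namespace PrimeDivisor

variable {A : Type*} [CommRing A]

instance (P : PrimeDivisor A) : P.asIdeal.IsPrime := P.isPrime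

/-- The local ring of `Spec A` along the prime divisor `P`. -/
abbrev LocalRing (P : PrimeDivisor A) : Type _ := Localization.AtPrime P.asIdeal

variable [IsDomain A]

/-- The field of rational functions is an algebra over the local ring along `P`. -/
instance (P : PrimeDivisor A) : Algebra P.LocalRing (FractionRing A) :=
  (IsLocalization.lift (M := P.asIdeal.primeCompl) (S := P.LocalRing)
    (g := algebraMap A (FractionRing A)) fun y =>
      IsLocalization.map_units (M := nonZeroDivisors A) (FractionRing A)
        ⟨y.1, P.asIdeal.primeCompl_le_nonZeroDivisors y.2⟩).toAlgebra

instance (P : PrimeDivisor A) : IsScalarTower A P.LocalRing (FractionRing A) :=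
  IsScalarTower.of_algebraMap_eq fun x => (IsLocalization.lift_eq _ x).symm

instance (P : PrimeDivisor A) : IsFractionRing P.LocalRing (FractionRing A) :=
  IsFractionRing.isFractionRing_of_isDomain_of_isLocalization P.asIdeal.primeCompl P.LocalRing
    (FractionRing A)

variable [IsNoetherianRing A] [IsIntegrallyClosed A]

instance (P : PrimeDivisor A) : IsDiscreteValuationRing P.LocalRing := by
  have hdim : ringKrullDim P.LocalRing = 1 := by
    rw [IsLocalization.AtPrime.ringKrullDim_eq_height P.asIdeal P.LocalRing, P.height_eq]
    rfl
  have hnf : ¬ IsField P.LocalRing := by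
    intro h
    rw [ringKrullDim_eq_zero_of_isField h] at hdim
    exact zero_ne_one hdim
  have h1 : Ring.KrullDimLE 1 P.LocalRing := by
    rw [Ring.KrullDimLE, Order.krullDimLE_iff]
    exact hdim.le
  have h2 : IsIntegrallyClosed P.LocalRing :=
    isIntegrallyClosed_of_isLocalization _ P.asIdeal.primeCompl
      P.asIdeal.primeCompl_le_nonZeroDivisors
  have h3 : Ring.DimensionLEOne P.LocalRing :=
    ⟨fun {I} hI hp => Ring.krullDimLE_one_iff_of_noZeroDivisors.mp h1 I hI hp⟩
  have h4 : IsDedekindDomain P.LocalRing := { }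
  exact ((IsDiscreteValuationRing.TFAE P.LocalRing hnf).out 0 2).mpr h4

/-- The order of vanishing of the rational function `f` along `P` (with value `0` at `f = 0`). -/
def ord (P : PrimeDivisor A) (f : FractionRing A) : ℤ :=
  WithZero.log (Ring.ordFrac P.LocalRing f)

theorem ord_one (P : PrimeDivisor A) : P.ord 1 = 0 := by simp [ord]

theorem ord_mul (P : PrimeDivisor A) {f g : FractionRing A} (hf : f ≠ 0) (hg : g ≠ 0) :
    P.ord (f * g) = P.ord f + P.ord g := by
  rw [ord, map_mul, WithZero.log_mul] <;> simp [ord, hf, hg]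

theorem ord_inv (P : PrimeDivisor A) (f : FractionRing A) : P.ord f⁻¹ = - P.ord f := by
  simp [ord]

theorem le_ord_add (P : PrimeDivisor A) {f g : FractionRing A} (hf : f ≠ 0) (hg : g ≠ 0)
    (hfg : f + g ≠ 0) {n : ℤ} (h1 : n ≤ P.ord f) (h2 : n ≤ P.ord g) : n ≤ P.ord (f + g) := by
  have h := Ring.ordFrac_add (R := P.LocalRing) f g hfg
  have hf' : Ring.ordFrac P.LocalRing f ≠ 0 := by simpa
  have hg' : Ring.ordFrac P.LocalRing g ≠ 0 := by simpa
  have hfg' : Ring.ordFrac P.LocalRing (f + g) ≠ 0 := by simpa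
  unfold ord at *
  rw [WithZero.le_log_iff_exp_le hf'] at h1
  rw [WithZero.le_log_iff_exp_le hg'] at h2
  rw [WithZero.le_log_iff_exp_le hfg']
  exact (le_min h1 h2).trans h

theorem ord_algebraMap (P : PrimeDivisor A) {K : Type*} [Field K] [Algebra K A] {c : K}
    (hc : c ≠ 0) : P.ord (algebraMap A (FractionRing A) (algebraMap K A c)) = 0 := by
  rw [IsScalarTower.algebraMap_apply A P.LocalRing (FractionRing A), ord,
    Ring.ordFrac_of_isUnit]
  · simp
  · exact ((hc.isUnit).map (algebraMap K A)).map _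

end PrimeDivisor

/-- Weil divisors: formal integral combinations of prime divisors. -/
abbrev WeilDivisor (A : Type*) [CommRing A] : Type _ := PrimeDivisor A →₀ ℤ

section Divisors

variable {A : Type*} [CommRing A] [IsDomain A] [IsNoetherianRing A] [IsIntegrallyClosed A]

/-- `D` is the divisor `(f)` of the nonzero rational function `f`. -/
def IsDivisorOf (f : FractionRing A) (D : WeilDivisor A) : Prop :=
  f ≠ 0 ∧ ∀ P : PrimeDivisor A, D P = P.ord f

variable (A) in
/-- The subgroup of principal divisors. -/
def principalDivisors : AddSubgroup (WeilDivisor A) where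
  carrier := {D | ∃ f : FractionRing A, IsDivisorOf f D}
  zero_mem' := ⟨1, one_ne_zero, fun P => by simp [P.ord_one]⟩
  add_mem' := by
    rintro D D' ⟨f, hf, hD⟩ ⟨g, hg, hD'⟩
    exact ⟨f * g, mul_ne_zero hf hg, fun P => by
      rw [P.ord_mul hf hg, Finsupp.add_apply, hD, hD']⟩
  neg_mem' := by
    rintro D ⟨f, hf, hD⟩
    exact ⟨f⁻¹, inv_ne_zero hf, fun P => by rw [P.ord_inv, Finsupp.neg_apply, hD]⟩

variable (A) in
/-- The divisor class group `Cl(X)`. -/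
abbrev DivisorClassGroup : Type _ := WeilDivisor A ⧸ principalDivisors A

/-- The class of a divisor in `Cl(X)`. -/
def divisorClass (D : WeilDivisor A) : DivisorClassGroup A := QuotientAddGroup.mk D

/-- The space `H⁰(X, D)` of rational functions `f` with `f = 0` or `(f) + D ≥ 0`. -/
def H0 (K : Type*) [Field K] [Algebra K A] (D : WeilDivisor A) :
    Submodule K (FractionRing A) where
  carrier := {f | f ≠ 0 → ∀ P : PrimeDivisor A, 0 ≤ P.ord f + D P}
  zero_mem' := fun h => (h rfl).elim
  add_mem' := by
    intro f g hf hg hfg P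
    by_cases hf0 : f = 0
    · subst hf0
      rw [zero_add] at hfg ⊢
      exact hg hfg P
    by_cases hg0 : g = 0
    · subst hg0
      rw [add_zero] at hfg ⊢
      exact hf hfg P
    have := P.le_ord_add hf0 hg0 hfg (n := -D P) (by linarith [hf hf0 P]) (by linarith [hg hg0 P])
    linarith
  smul_mem' := by
    intro c f hf hcf P
    have hc : c ≠ 0 := by
      rintro rfl
      exact hcf (zero_smul K f)
    have hf0 : f ≠ 0 := by
      rintro rfl
      exact hcf (smul_zero c)
    have h1 : c • f = algebraMap A (FractionRing A) (algebraMap K A c) * f := by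
      rw [← IsScalarTower.algebraMap_apply, Algebra.smul_def]
    have h2 : algebraMap A (FractionRing A) (algebraMap K A c) ≠ 0 := by
      rw [← IsScalarTower.algebraMap_apply]
      simpa using hc
    rw [h1, P.ord_mul h2 hf0, P.ord_algebraMap hc, zero_add]
    exact hf hf0 P

end Divisors

/-! ### The generalized total coordinate ring -/

/-- The choices made in the construction of `S(X)`: a decomposition
`Cl(X) ≅ ℤⁿ ⊕ ℤ/k₁ ⊕ ⋯ ⊕ ℤ/kₛ`, divisors `E i` and `W j` whose classes are the corresponding
generators, and rational functions `F j` with `(F j) = k j • W j`. -/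
structure ClassGroupSplitting (A : Type*) [CommRing A] [IsDomain A] [IsNoetherianRing A]
    [IsIntegrallyClosed A] where
  n : ℕ
  s : ℕ
  k : Fin s → ℕ
  k_neZero : ∀ j, NeZero (k j)
  equiv : ((Fin n → ℤ) × ((j : Fin s) → ZMod (k j))) ≃+ DivisorClassGroup A
  E : Fin n → WeilDivisor A
  W : Fin s → WeilDivisor A
  class_E : ∀ i, divisorClass (E i) = equiv (Pi.single i 1, 0)
  class_W : ∀ j, divisorClass (W j) = equiv (0, Pi.single j 1)
  F : Fin s → FractionRing A
  div_F : ∀ j, IsDivisorOf (F j) (k j • W j)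

namespace ClassGroupSplitting

variable {A : Type*} [CommRing A] [IsDomain A] [IsNoetherianRing A] [IsIntegrallyClosed A]
variable (𝒮 : ClassGroupSplitting A)

/-- The grading group `ℤⁿ ⊕ ℤ/k₁ ⊕ ⋯ ⊕ ℤ/kₛ` of `S(X)`. -/
abbrev Degree : Type := (Fin 𝒮.n → ℤ) × ((j : Fin 𝒮.s) → ZMod (𝒮.k j))

/-- The divisor `∑ λᵢ Eᵢ + ∑ μⱼ Wⱼ` with `0 ≤ μⱼ < kⱼ` attached to a degree. -/
def rep (g : 𝒮.Degree) : WeilDivisor A :=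
  ∑ i, g.1 i • 𝒮.E i + ∑ j, (g.2 j).val • 𝒮.W j

/-- The integer `⌊(b j + d j) / k j⌋` for the representatives `0 ≤ b j, d j < k j`. -/
def carry (g h : 𝒮.Degree) (j : Fin 𝒮.s) : ℕ := ((g.2 j).val + (h.2 j).val) / 𝒮.k j

/-- The correction factor `∏ j, F j ^ ⌊(b j + d j) / k j⌋`. -/
def correction (g h : 𝒮.Degree) : FractionRing A := ∏ j, 𝒮.F j ^ 𝒮.carry g h j

variable (K : Type*) [Field K] [Algebra K A]

/-- The homogeneous component of `S(X)` of a given degree. -/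
abbrev Component (g : 𝒮.Degree) : Type _ := H0 K (𝒮.rep g)

open scoped DirectSum in
/-- The total coordinate ring `S(X)`, as the direct sum of its homogeneous components. -/
abbrev TotalCoordinateRing : Type _ := ⨁ g : 𝒮.Degree, 𝒮.Component K g

theorem val_add_carry (g h : 𝒮.Degree) (j : Fin 𝒮.s) :
    ((g + h).2 j).val + 𝒮.k j * 𝒮.carry g h j = (g.2 j).val + (h.2 j).val := by
  have := 𝒮.k_neZero j
  rw [Prod.snd_add, Pi.add_apply, ZMod.val_add]
  exact Nat.mod_add_div _ _

theorem correction_ne_zero (g h : 𝒮.Degree) : 𝒮.correction g h ≠ 0 :=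
  Finset.prod_ne_zero_iff.mpr fun j _ => pow_ne_zero _ (𝒮.div_F j).1

theorem carry_comm (g h : 𝒮.Degree) (j : Fin 𝒮.s) : 𝒮.carry g h j = 𝒮.carry h g j := by
  rw [carry, carry, add_comm]

theorem carry_assoc (g h l : 𝒮.Degree) (j : Fin 𝒮.s) :
    𝒮.carry g h j + 𝒮.carry (g + h) l j = 𝒮.carry h l j + 𝒮.carry g (h + l) j := by
  have hk : 0 < 𝒮.k j := Nat.pos_of_ne_zero (𝒮.k_neZero j).out
  have h1 := 𝒮.val_add_carry g h j
  have h2 := 𝒮.val_add_carry (g + h) l j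
  have h3 := 𝒮.val_add_carry h l j
  have h4 := 𝒮.val_add_carry g (h + l) j
  rw [← add_assoc g h l] at h4
  apply Nat.eq_of_mul_eq_mul_left hk
  rw [mul_add, mul_add]
  omega

theorem carry_zero_left (g : 𝒮.Degree) (j : Fin 𝒮.s) : 𝒮.carry 0 g j = 0 := by
  have := 𝒮.k_neZero j
  simp [carry, Nat.div_eq_of_lt (ZMod.val_lt (g.2 j))]

theorem correction_comm (g h : 𝒮.Degree) : 𝒮.correction g h = 𝒮.correction h g := by
  simp only [correction, 𝒮.carry_comm g h]

theorem correction_assoc (g h l : 𝒮.Degree) :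
    𝒮.correction g h * 𝒮.correction (g + h) l = 𝒮.correction h l * 𝒮.correction g (h + l) := by
  simp only [correction, ← Finset.prod_mul_distrib, ← pow_add, 𝒮.carry_assoc g h l]

theorem correction_zero_left (g : 𝒮.Degree) : 𝒮.correction 0 g = 1 := by
  simp [correction, 𝒮.carry_zero_left]

theorem ord_prod_pow (P : PrimeDivisor A) (t : Finset (Fin 𝒮.s)) (c : Fin 𝒮.s → ℕ) :
    P.ord (∏ j ∈ t, 𝒮.F j ^ c j) = ∑ j ∈ t, (c j : ℤ) * (𝒮.k j * 𝒮.W j P) := by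
  induction t using Finset.cons_induction with
  | empty => simp [P.ord_one]
  | cons j t hj ih =>
    have hF := (𝒮.div_F j).1
    rw [Finset.prod_cons, Finset.sum_cons, P.ord_mul (pow_ne_zero _ hF)
      (Finset.prod_ne_zero_iff.mpr fun i _ => pow_ne_zero _ (𝒮.div_F i).1), ih]
    congr 1
    have h1 := (𝒮.div_F j).2 P
    rw [Finsupp.smul_apply, nsmul_eq_mul] at h1
    rw [PrimeDivisor.ord, map_pow, WithZero.log_pow, nsmul_eq_mul, h1, PrimeDivisor.ord]

theorem ord_correction (P : PrimeDivisor A) (g h : 𝒮.Degree) :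
    P.ord (𝒮.correction g h) + 𝒮.rep (g + h) P = 𝒮.rep g P + 𝒮.rep h P := by
  have key : ∀ j, (((g + h).2 j).val : ℤ) = (g.2 j).val + (h.2 j).val
      - 𝒮.k j * 𝒮.carry g h j := fun j => by
    have := 𝒮.val_add_carry g h j
    zify at this
    linarith
  rw [correction, ord_prod_pow]
  simp only [rep, Finsupp.add_apply, Finsupp.finsetSum_apply, Finsupp.smul_apply, nsmul_eq_mul,
    key, Prod.fst_add, Pi.add_apply, smul_eq_mul]
  have e1 : ∑ j, (((g.2 j).val : ℤ) + (h.2 j).val - 𝒮.k j * 𝒮.carry g h j) * 𝒮.W j P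
      = ∑ j, ((g.2 j).val : ℤ) * 𝒮.W j P + ∑ j, ((h.2 j).val : ℤ) * 𝒮.W j P
        - ∑ j, (𝒮.carry g h j : ℤ) * (𝒮.k j * 𝒮.W j P) := by
    rw [← Finset.sum_add_distrib, ← Finset.sum_sub_distrib]
    exact Finset.sum_congr rfl fun j _ => by ring
  have e2 : ∑ i, (g.1 i + h.1 i) * 𝒮.E i P = ∑ i, g.1 i * 𝒮.E i P + ∑ i, h.1 i * 𝒮.E i P := by
    rw [← Finset.sum_add_distrib]
    exact Finset.sum_congr rfl fun j _ => by ring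
  rw [e1, e2]
  ring

theorem mul_mem (g h : 𝒮.Degree) {a b : FractionRing A} (ha : a ∈ H0 K (𝒮.rep g))
    (hb : b ∈ H0 K (𝒮.rep h)) : a * b * 𝒮.correction g h ∈ H0 K (𝒮.rep (g + h)) := by
  intro h0 P
  have ha0 : a ≠ 0 := fun h' => h0 (by rw [h', zero_mul, zero_mul])
  have hb0 : b ≠ 0 := fun h' => h0 (by rw [h', mul_zero, zero_mul])
  have h1 := ha ha0 P
  have h2 := hb hb0 P
  have h3 := 𝒮.ord_correction P g h
  rw [P.ord_mul (mul_ne_zero ha0 hb0) (𝒮.correction_ne_zero g h), P.ord_mul ha0 hb0]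
  linarith

theorem rep_zero : 𝒮.rep 0 = 0 := by
  have : ∀ j, ((0 : 𝒮.Degree).2 j).val = 0 := fun j => by
    have := 𝒮.k_neZero j
    simp
  simp [rep]

theorem algebraMap_mem (c : K) : algebraMap K (FractionRing A) c ∈ H0 K (𝒮.rep 0) := by
  have h1 : (1 : FractionRing A) ∈ H0 K (𝒮.rep 0) := fun _ P => by
    rw [𝒮.rep_zero, P.ord_one]
    simp
  rw [Algebra.algebraMap_eq_smul_one]
  exact Submodule.smul_mem _ c h1

/-- The inclusion of the constants into the component of degree zero. -/
def const : K →+ 𝒮.Component K 0 where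
  toFun c := ⟨algebraMap K (FractionRing A) c, 𝒮.algebraMap_mem K c⟩
  map_zero' := Subtype.ext (map_zero _)
  map_add' _ _ := Subtype.ext (map_add _ _ _)

/-- The product `f * g = f g ∏ F j ^ ⌊(b j + d j) / k j⌋` of homogeneous elements. -/
instance : GradedMonoid.GMul (𝒮.Component K) where
  mul {g h} a b := ⟨a.1 * b.1 * 𝒮.correction g h, 𝒮.mul_mem K g h a.2 b.2⟩

instance : GradedMonoid.GOne (𝒮.Component K) where
  one := 𝒮.const K 1

/-- `S(X)` is a commutative ring graded by the divisor class group. -/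
instance : DirectSum.GCommRing (𝒮.Component K) where
  mul_zero a := Subtype.ext (by simp [GradedMonoid.GMul.mul])
  zero_mul a := Subtype.ext (by simp [GradedMonoid.GMul.mul])
  mul_add a b c := Subtype.ext (by simp [GradedMonoid.GMul.mul]; ring)
  add_mul a b c := Subtype.ext (by simp [GradedMonoid.GMul.mul]; ring)
  one_mul := fun ⟨g, a⟩ => Sigma.subtype_ext (zero_add g) (by
    change algebraMap K (FractionRing A) 1 * a.1 * 𝒮.correction 0 g = a.1
    rw [𝒮.correction_zero_left, map_one, one_mul, mul_one])
  mul_one := fun ⟨g, a⟩ => Sigma.subtype_ext (add_zero g) (by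
    change a.1 * algebraMap K (FractionRing A) 1 * 𝒮.correction g 0 = a.1
    rw [𝒮.correction_comm, 𝒮.correction_zero_left, map_one, mul_one, mul_one])
  mul_assoc := fun ⟨g, a⟩ ⟨h, b⟩ ⟨l, c⟩ => Sigma.subtype_ext (add_assoc g h l) (by
    change a.1 * b.1 * 𝒮.correction g h * c.1 * 𝒮.correction (g + h) l
      = a.1 * (b.1 * c.1 * 𝒮.correction h l) * 𝒮.correction g (h + l)
    linear_combination a.1 * b.1 * c.1 * 𝒮.correction_assoc g h l)
  mul_comm := fun ⟨g, a⟩ ⟨h, b⟩ => Sigma.subtype_ext (add_comm g h) (by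
    change a.1 * b.1 * 𝒮.correction g h = b.1 * a.1 * 𝒮.correction h g
    rw [𝒮.correction_comm g h, mul_comm a.1 b.1])
  natCast m := 𝒮.const K m
  natCast_zero := by simp
  natCast_succ m := by
    rw [Nat.cast_succ, map_add]
    rfl
  intCast m := 𝒮.const K m
  intCast_ofNat m := by simp
  intCast_negSucc_ofNat m := by rw [Int.cast_negSucc, map_neg]

/-- `S(X)` is a `K`-algebra. -/
instance : DirectSum.GAlgebra K (𝒮.Component K) where
  toFun := 𝒮.const K
  map_one := rfl
  map_mul c d := Sigma.subtype_ext (zero_add 0).symm (by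
    change algebraMap K (FractionRing A) (c * d)
      = algebraMap K (FractionRing A) c * algebraMap K (FractionRing A) d * 𝒮.correction 0 0
    rw [𝒮.correction_zero_left, map_mul, mul_one])
  commutes c := fun ⟨g, a⟩ => Sigma.subtype_ext (by
    change 0 + g = g + 0
    rw [add_comm]) (by
    change algebraMap K (FractionRing A) c * a.1 * 𝒮.correction 0 g
      = a.1 * algebraMap K (FractionRing A) c * 𝒮.correction g 0
    rw [𝒮.correction_comm 0 g, mul_comm a.1])
  smul_def c := fun ⟨g, a⟩ => Sigma.subtype_ext (zero_add g).symm (by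
    change c • a.1 = algebraMap K (FractionRing A) c * a.1 * 𝒮.correction 0 g
    rw [𝒮.correction_zero_left, mul_one, Algebra.smul_def])

end ClassGroupSplitting

/-! ### Torus actions on affine varieties -/

/-- The character `χᵐ` of the torus `(Kˣ)ʳ` given by `m ∈ M = ℤʳ`. -/
def torusCharacter {K : Type*} [Field K] {r : ℕ} (m : Fin r → ℤ) (t : Fin r → Kˣ) : Kˣ :=
  ∏ i, t i ^ m i

/-- A regular action of the torus `T = (Kˣ)ʳ` on the affine variety `X` with coordinate ring `A`,
given by the pullbacks `f ↦ (x ↦ f (t · x))`.  Regularity of `T × X → X` says that every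
`f (t · x)` is a finite sum `∑ χᵐ(t) fₘ(x)`. -/
structure TorusAction (K : Type*) [Field K] (r : ℕ) (A : Type*) [CommRing A] [Algebra K A] where
  act : (Fin r → Kˣ) →* (A ≃ₐ[K] A)
  regular : ∀ a : A, ∃ p : (Fin r → ℤ) →₀ A, ∀ t : Fin r → Kˣ,
    act t a = p.sum fun m b => (torusCharacter m t : K) • b

namespace TorusAction

variable {K : Type*} [Field K] {r : ℕ} {A : Type*} [CommRing A] [Algebra K A]
variable (T : TorusAction K r A)

/-- The orbit of the (closed) point `x` under the torus: the ideal of functions vanishing at `t · x`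
is the preimage of the ideal of `x` under the pullback by `t`. -/
def orbit (x : MaximalSpectrum A) : Set (MaximalSpectrum A) :=
  {y | ∃ t, y.asIdeal = x.asIdeal.comap (T.act t : A →+* A)}

/-- The action is locally transitive: some orbit is Zariski open. -/
def LocallyTransitive : Prop := ∃ x : MaximalSpectrum A, IsOpen (T.orbit x)

/-- The action is effective: only the neutral element of `T` acts trivially. -/
def Effective : Prop := Function.Injective T.act

/-- `a` is a semi-invariant function of weight `m`, that is, `a (t · x) = χᵐ(t) a(x)`. -/
def IsWeightVector (m : Fin r → ℤ) (a : A) : Prop :=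
  ∀ t, T.act t a = (torusCharacter m t : K) • a

/-- The weight semigroup of `K[X]`, in `M_ℚ = ℚʳ`. -/
def weights : Set (Fin r → ℚ) :=
  {v | ∃ (m : Fin r → ℤ) (a : A), a ≠ 0 ∧ T.IsWeightVector m a ∧ v = fun i => (m i : ℚ)}

/-- The cone `σ` of the toric variety in `N_ℚ = ℚʳ`: the dual of the cone generated by the weights
of `K[X]`. -/
def cone : PointedCone ℚ (Fin r → ℚ) := PointedCone.dual (dotProductBilin ℚ ℚ) T.weights

/-- The set `Δ(1)` of one-dimensional faces of `σ`. -/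
def Ray : Type :=
  {ρ : PointedCone ℚ (Fin r → ℚ) //
    ρ.IsFaceOf T.cone ∧ Module.finrank ℚ (Submodule.span ℚ (ρ : Set (Fin r → ℚ))) = 1}

/-- The ideal of the closed `T`-stable subset `D_ρ` attached to the ray `ρ`: it is generated by the
weight vectors whose weight is positive on `ρ ∖ {0}`. -/
def rayIdeal (ρ : T.Ray) : Ideal A :=
  Ideal.span {a | ∃ m : Fin r → ℤ, T.IsWeightVector m a ∧
    ∃ v ∈ ρ.1, 0 < (fun i => (m i : ℚ)) ⬝ᵥ v}

/-- The prime divisor `P` is `T`-invariant. -/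
def Invariant (P : PrimeDivisor A) : Prop :=
  ∀ t, P.asIdeal.comap (T.act t : A →+* A) = P.asIdeal

end TorusAction

end

/-!
The open orbit identifies the function field of `X` with that of the torus, so every lattice point
`m` gives a rational semi-invariant function `χᵐ`, unique up to a scalar. On the open orbit,
functions are Laurent polynomials; these form a factorial ring, so every non-invariant prime divisor
is principal there, and a rational function without zeros or poles there is a multiple of some
`χᵐ`. The invariant prime divisors are finitely many, and the vectors `m ↦ ord_P χᵐ` attached to
them generate `σ` by Farkas' lemma and span its distinct rays.

Consequently every divisor is equivalent to an invariant one, so `Cl(X)` is finitely generated, and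
`H⁰(X, E)` is spanned by the functions `f` for which `(f) + E` is effective and invariant, that is,
the divisor of a monomial in the `x_ρ`. As invertible functions are constant, `f` is determined by
this divisor up to a scalar. Hence sending `x_ρ` to a section whose divisor of zeros is `D_ρ` maps
the monomials of degree `α` to a basis of the component of degree `α`.
-/

noncomputable section

/-! ### Algebraic preliminaries -/

theorem eq_zero_of_forall_linearIndependent_fiber {K V N κ I : Type*} [Ring K] [AddCommGroup V]
    [Module K V] [AddCommGroup N] [Module K N] (b : Module.Basis κ K V) (deg : κ → I)
    (π : I → V →ₗ[K] N) (hπ : ∀ i k, deg k ≠ i → π i (b k) = 0)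
    (h : ∀ i, LinearIndependent K fun k : {k // deg k = i} => π i (b k)) {v : V}
    (hv : ∀ i, π i v = 0) : v = 0 := by
  classical
  refine b.ext_elem fun k₀ => ?_
  rw [map_zero, Finsupp.zero_apply]
  have hsum : ∑ k ∈ (b.repr v).support.subtype (deg · = deg k₀),
      b.repr v k • π (deg k₀) (b k) = 0 := by
    have hv₀ := hv (deg k₀)
    rw [← b.linearCombination_repr v, Finsupp.linearCombination_apply, map_finsuppSum,
      Finsupp.sum] at hv₀
    rw [Finset.sum_subtype_eq_sum_filter (f := fun k => b.repr v k • π (deg k₀) (b k)),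
      Finset.sum_filter]
    refine (Finset.sum_congr rfl fun k _ => ?_).trans hv₀
    rw [map_smul]
    split_ifs with hk
    · rfl
    · rw [hπ _ _ hk, smul_zero]
  by_contra hk₀
  exact hk₀ (linearIndependent_iff'.mp (h (deg k₀)) _ (fun k => b.repr v k) hsum ⟨k₀, rfl⟩
    (by simpa using hk₀))

section MaximalSpectrum

variable {A : Type*} [CommRing A]

theorem eq_zero_of_isOpen_of_forall_mem [IsDomain A] [IsJacobsonRing A]
    {U : Set (MaximalSpectrum A)} (hU : IsOpen U) (hne : U.Nonempty) {a : A}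
    (h : ∀ y ∈ U, a ∈ y.asIdeal) : a = 0 := by
  obtain ⟨x, hx⟩ := hne
  obtain ⟨V, hV, rfl⟩ := isOpen_induced_iff.mp hU
  obtain ⟨_, ⟨f, rfl⟩, hxf, hfV⟩ :=
    PrimeSpectrum.isTopologicalBasis_basic_opens.exists_subset_of_mem_open hx hV
  have hfa : f * a = 0 := by
    rw [← Ideal.mem_bot, ← IsJacobsonRing.out ‹_› (Ideal.isPrime_bot (α := A)).isRadical,
      Ideal.jacobson, Ideal.mem_sInf]
    rintro J ⟨-, hJ⟩
    by_cases hfJ : f ∈ J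
    · exact J.mul_mem_right _ hfJ
    · exact J.mul_mem_left _ (h ⟨J, hJ⟩ (hfV hfJ))
  refine (mul_eq_zero.mp hfa).resolve_left ?_
  rintro rfl
  exact hxf (Ideal.zero_mem _)

theorem exists_sub_smul_mem (K : Type*) [Field K] [IsAlgClosed K] [Algebra K A]
    [Algebra.FiniteType K A] (x : Ideal A) [x.IsMaximal] (a : A) {b : A} (hb : b ∉ x) :
    ∃ c : K, a - c • b ∈ x := by
  let _ := Ideal.Quotient.field x
  have : Module.Finite K (A ⧸ x) := finite_of_finite_type_of_isJacobsonRing _ _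
  obtain ⟨c, hc⟩ := (IsAlgClosed.algebraMap_bijective_of_isIntegral (k := K) (K := A ⧸ x)).2
    (Ideal.Quotient.mk x a / Ideal.Quotient.mk x b)
  have hb' : Ideal.Quotient.mk x b ≠ 0 := by rwa [Ne, Ideal.Quotient.eq_zero_iff_mem]
  refine ⟨c, ?_⟩
  rw [← Ideal.Quotient.eq, Algebra.smul_def, map_mul, Ideal.Quotient.mk_algebraMap, hc,
    div_mul_cancel₀ _ hb']

end MaximalSpectrum

section LaurentPolynomials

open scoped AddMonoidAlgebra LaurentPolynomial

variable {R M : Type*} [CommRing R]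

theorem uniqueFactorizationMonoid_laurentPolynomial [UniqueFactorizationMonoid R] :
    UniqueFactorizationMonoid R[T;T⁻¹] :=
  .of_isLocalization (Submonoid.powers (Polynomial.X : Polynomial R)) _

theorem uniqueFactorizationMonoid_addMonoidAlgebra_int [UniqueFactorizationMonoid R] (r : ℕ) :
    UniqueFactorizationMonoid R[Fin r → ℤ] := by
  induction r with
  | zero =>
    exact (AddMonoidAlgebra.uniqueRingEquiv (R := R) (Fin 0 → ℤ)).symm.toMulEquiv
      |>.uniqueFactorizationMonoid ‹_›
  | succ r ih =>
    let e := (Fin.consLinearEquiv ℤ fun _ : Fin (r + 1) => ℤ).toAddEquiv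
    exact (AddMonoidAlgebra.curryRingEquiv.symm.trans
      (AddMonoidAlgebra.domCongr ℤ R e).toRingEquiv).toMulEquiv
        |>.uniqueFactorizationMonoid uniqueFactorizationMonoid_laurentPolynomial

theorem exists_eq_single_of_isUnit [NoZeroDivisors R] [Nontrivial R] [AddCommGroup M]
    [TwoUniqueSums M] {u : R[M]} (hu : IsUnit u) :
    ∃ m, ∃ c ≠ 0, u = AddMonoidAlgebra.single m c := by
  obtain ⟨v, huv⟩ := hu.exists_right_inv
  -- The coefficient of `u * v = 1` at a unique sum does not vanish, so this sum is `0`.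
  have hzero : ∀ x ∈ u.coeff.support ×ˢ v.coeff.support,
      UniqueAdd u.coeff.support v.coeff.support x.1 x.2 → x.1 + x.2 = 0 := by
    intro x hx hx'
    rw [Finset.mem_product, Finsupp.mem_support_iff, Finsupp.mem_support_iff] at hx
    have h := AddMonoidAlgebra.coeff_mul_add_of_uniqueAdd hx'
    contrapose! h
    simpa [huv, AddMonoidAlgebra.one_def, Finsupp.single_apply, h.symm] using hx
  have hcard : u.coeff.support.card * v.coeff.support.card ≤ 1 := by
    by_contra! hlt
    obtain ⟨p, hp, q, hq, hpq, hp', hq'⟩ := TwoUniqueSums.uniqueAdd_of_one_lt_card hlt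
    have hmem := Finset.mem_product.mp hq
    have hsum := (hzero q hq hq').trans (hzero p hp hp').symm
    exact hpq (Prod.ext_iff.mpr (hp' hmem.1 hmem.2 hsum)).symm
  have hpos : 0 < u.coeff.support.card * v.coeff.support.card := by
    have hu0 := left_ne_zero_of_mul_eq_one huv
    have hv0 := right_ne_zero_of_mul_eq_one huv
    simpa [Nat.pos_iff_ne_zero] using ⟨hu0, hv0⟩
  obtain ⟨m, c, hc, hm⟩ := Finsupp.card_support_eq_one'.mp
    (Nat.eq_one_of_mul_eq_one_right (hcard.antisymm hpos))
  exact ⟨m, c, hc, AddMonoidAlgebra.coeff_injective (by simpa using hm)⟩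

end LaurentPolynomials

section FixedPoints

-- A divisible group has no proper subgroup of finite index.
theorem mem_fixedPoints_of_finite_orbit {G α : Type*} [CommGroup G] [MulAction G α]
    (hG : ∀ n ≠ 0, Function.Surjective fun g : G => g ^ n) {x : α}
    (hx : (MulAction.orbit G x).Finite) : x ∈ MulAction.fixedPoints G α := by
  have : (MulAction.stabilizer G x).FiniteIndex := by
    have := hx.to_subtype
    have := Finite.of_equiv _ (MulAction.orbitEquivQuotientStabilizer G x)
    exact Subgroup.finiteIndex_of_finite_quotient
  intro g
  have hindex : (MulAction.stabilizer G x).index ≠ 0 := Subgroup.FiniteIndex.index_ne_zero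
  obtain ⟨h, rfl⟩ := hG _ hindex g
  exact (MulAction.stabilizer G x).pow_index_mem h

theorem pow_units_surjective {K : Type*} [Field K] [IsAlgClosed K] {I : Type*} {n : ℕ}
    (hn : n ≠ 0) : Function.Surjective fun t : I → Kˣ => t ^ n := by
  intro t
  choose u hu using fun i => IsAlgClosed.exists_pow_nat_eq (t i : K) (Nat.pos_of_ne_zero hn)
  have hu0 : ∀ i, u i ≠ 0 := fun i h0 => (t i).ne_zero (by rw [← hu i, h0, zero_pow hn])
  exact ⟨fun i => .mk0 (u i) (hu0 i), funext fun i => Units.ext (hu i)⟩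

end FixedPoints

/-! ### Polyhedral cones -/

section Cones

open PointedCone

variable {𝕜 V W : Type*} [Field 𝕜] [LinearOrder 𝕜] [IsStrictOrderedRing 𝕜]
variable [AddCommGroup V] [Module 𝕜 V] [AddCommGroup W] [Module 𝕜 W]

-- `w ↦ -f v • w + f w • v` is, up to scaling, the projection along `v` onto `ker f`.
theorem mem_hull_insert_of_projection_mem_hull {f : W →ₗ[𝕜] 𝕜} {s : Set W} {v b : W}
    (hs : ∀ w ∈ s, 0 ≤ f w) (hv : f v < 0) (hb : f b ≤ 0)
    (h : -f v • b + f b • v ∈ hull 𝕜 ((fun w => -f v • w + f w • v) '' s)) :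
    b ∈ hull 𝕜 (insert v s) := by
  have hμ : 0 < -f v := neg_pos.mpr hv
  have hvmem : v ∈ hull 𝕜 (insert v s) := subset_hull (Set.mem_insert v s)
  have hle : hull 𝕜 ((fun w => -f v • w + f w • v) '' s) ≤ hull 𝕜 (insert v s) := by
    refine Submodule.span_le.mpr (Set.image_subset_iff.mpr fun w hw => ?_)
    exact add_mem (PointedCone.smul_mem _ hμ.le (subset_hull (Set.mem_insert_of_mem v hw)))
      (PointedCone.smul_mem _ (hs w hw) hvmem)
  have hsum : b = (-f v)⁻¹ • ((-f v • b + f b • v) + (-f b) • v) := by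
    rw [neg_smul (f b), add_neg_cancel_right, inv_smul_smul₀ hμ.ne']
  rw [hsum]
  exact PointedCone.smul_mem _ (inv_pos.mpr hμ).le
    (add_mem (hle h) (PointedCone.smul_mem _ (neg_nonneg.mpr hb) hvmem))

theorem mem_hull_image_of_forall_nonneg {κ : Type*} {p : V →ₗ[𝕜] W →ₗ[𝕜] 𝕜}
    (hp : Function.Injective p.flip) (s : Finset κ) (a : κ → W) (b : W)
    (h : ∀ x, (∀ i ∈ s, 0 ≤ p x (a i)) → 0 ≤ p x b) : b ∈ hull 𝕜 (a '' s) := by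
  classical
  induction s using Finset.induction_on generalizing a b with
  | empty =>
    have hb : p.flip b = 0 := by
      ext x
      have hneg : 0 ≤ p (-x) b := h (-x) (by simp)
      rw [map_neg, LinearMap.neg_apply, neg_nonneg] at hneg
      exact le_antisymm hneg (h x (by simp))
    rw [(map_eq_zero_iff p.flip hp).mp hb]
    exact zero_mem _
  | insert j s _ ih =>
    rw [Finset.coe_insert, Set.image_insert_eq]
    by_cases hs : ∀ x, (∀ i ∈ s, 0 ≤ p x (a i)) → 0 ≤ p x b
    · exact Submodule.span_mono (Set.subset_insert _ _) (ih a b hs)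
    push Not at hs
    obtain ⟨y, hy, hby⟩ := hs
    have hyj : p y (a j) < 0 := by
      by_contra! hcon
      exact hby.not_ge (h y (Finset.forall_mem_insert _ _ _ |>.mpr ⟨hcon, hy⟩))
    refine mem_hull_insert_of_projection_mem_hull (Set.forall_mem_image.mpr hy) hyj hby.le ?_
    have hshift (x : V) (c : W) :
        p x (-p y (a j) • c + p y c • a j) = p (-p y (a j) • x + p x (a j) • y) c := by
      simp [mul_comm]
    rw [Set.image_image]
    refine ih _ _ fun x hx => ?_
    simp only [hshift] at hx ⊢
    refine h _ (Finset.forall_mem_insert _ _ _ |>.mpr ⟨?_, hx⟩)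
    simp [mul_comm]

theorem dual_dual_flip_of_finite {p : V →ₗ[𝕜] W →ₗ[𝕜] 𝕜} (hp : Function.Injective p.flip)
    {s : Set W} (hs : s.Finite) : dual p (dual p.flip s : Set V) = hull 𝕜 s := by
  refine le_antisymm (fun b hb => ?_) (Submodule.span_le.mpr subset_dual_dual)
  have h := mem_hull_image_of_forall_nonneg hp hs.toFinset id b fun x hx =>
    hb (mem_dual.mpr fun {y} hy => hx y (hs.mem_toFinset.mpr hy))
  rwa [Set.image_id, hs.coe_toFinset] at h

theorem mem_hull_setOf_eq_zero {f : W →ₗ[𝕜] 𝕜} {s : Set W} (hf : ∀ w ∈ s, 0 ≤ f w) {v : W}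
    (hv : v ∈ hull 𝕜 s) (hv0 : f v = 0) : v ∈ hull 𝕜 {w ∈ s | f w = 0} := by
  suffices h : 0 ≤ f v ∧ (f v = 0 → v ∈ hull 𝕜 {w ∈ s | f w = 0}) from h.2 hv0
  clear hv0
  induction hv using Submodule.span_induction with
  | mem w hw => exact ⟨hf w hw, fun h0 => subset_hull ⟨hw, h0⟩⟩
  | zero => exact ⟨(map_zero f).ge, fun _ => zero_mem _⟩
  | add x y _ _ hx hy =>
    rw [map_add]
    refine ⟨add_nonneg hx.1 hy.1, fun h0 => ?_⟩
    obtain ⟨hx0, hy0⟩ := (add_eq_zero_iff_of_nonneg hx.1 hy.1).mp h0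
    exact add_mem (hx.2 hx0) (hy.2 hy0)
  | smul c x _ hx =>
    obtain ⟨c, hc⟩ := c
    change 0 ≤ f (c • x) ∧ (f (c • x) = 0 → c • x ∈ _)
    rw [map_smul, smul_eq_mul]
    refine ⟨mul_nonneg hc hx.1, fun h0 => ?_⟩
    rcases mul_eq_zero.mp h0 with rfl | h0
    · rw [zero_smul]
      exact zero_mem _
    · exact PointedCone.smul_mem _ hc (hx.2 h0)

theorem exists_ne_zero_mem_of_isFaceOf_hull {s : Set W} {F : PointedCone 𝕜 W}
    (hF : F.IsFaceOf (hull 𝕜 s)) {v : W} (hv : v ∈ F) (hv0 : v ≠ 0) :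
    ∃ w ∈ s, w ∈ F ∧ w ≠ 0 := by
  induction hF.le hv using Submodule.span_induction with
  | mem w hw => exact ⟨w, hw, hv, hv0⟩
  | zero => exact absurd rfl hv0
  | add x y hx hy ihx ihy =>
    obtain ⟨hxF, hyF⟩ := (hF.add_mem_iff_mem hx hy).mp hv
    rcases eq_or_ne x 0 with rfl | hx0
    · exact ihy hyF (by rwa [zero_add] at hv0)
    · exact ihx hxF hx0
  | smul c x hx ih =>
    obtain ⟨hc0, hx0⟩ := smul_ne_zero_iff.mp hv0
    have hc : (0 : 𝕜) < c := lt_of_le_of_ne c.2 fun h => hc0 (Subtype.ext h.symm)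
    refine ih (hF.mem_of_smul_add_mem (y := 0) hx (zero_mem _) hc ?_) hx0
    rw [add_zero]
    exact hv

theorem exists_intCast_eq_smul {κ : Type*} [Finite κ] (x : κ → ℚ) :
    ∃ c : ℚ, 0 < c ∧ ∃ m : κ → ℤ, (fun i => (m i : ℚ)) = c • x := by
  obtain ⟨⟨d, hd⟩, hdx⟩ := IsLocalization.exist_integer_multiples_of_finite (nonZeroDivisors ℤ) x
  choose m hm using hdx
  have hd0 : (d : ℚ) ≠ 0 := Int.cast_ne_zero.mpr (nonZeroDivisors.ne_zero hd)
  refine ⟨d * d, mul_self_pos.mpr hd0, fun i => d * m i, funext fun i => ?_⟩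
  have hmi : (m i : ℚ) = d * x i := by simpa using hm i
  rw [Int.cast_mul, hmi, Pi.smul_apply, smul_eq_mul, mul_assoc]

end Cones

/-! ### Divisors of rational functions -/

section Divisors

variable {A : Type*} [CommRing A]

local notation "ι" => algebraMap A (FractionRing A)

namespace PrimeDivisor

theorem asIdeal_injective : Function.Injective fun P : PrimeDivisor A => P.asIdeal :=
  fun _ _ h => PrimeDivisor.ext h

variable [IsDomain A]

theorem ne_bot (P : PrimeDivisor A) : P.asIdeal ≠ ⊥ :=
  Ideal.ne_bot_of_height_eq_one P.height_eq

variable [IsNoetherianRing A]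

theorem eq_asIdeal_of_le (P : PrimeDivisor A) {p : Ideal A} [p.IsPrime] (hp : p ≠ ⊥)
    (hle : p ≤ P.asIdeal) : p = P.asIdeal := by
  refine Ideal.eq_of_le_of_height_le p hle ?_
  rwa [P.height_eq, Order.one_le_iff_ne_zero, Ne, Ideal.height_eq_zero_iff_eq_bot]

theorem eq_of_le {P Q : PrimeDivisor A} (h : P.asIdeal ≤ Q.asIdeal) : P = Q :=
  asIdeal_injective (Q.eq_asIdeal_of_le P.ne_bot h)

theorem finite_setOf_mem {a : A} (ha : a ≠ 0) : {P : PrimeDivisor A | a ∈ P.asIdeal}.Finite := by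
  refine Set.Finite.of_finite_image (f := fun P : PrimeDivisor A => P.asIdeal)
    (((Ideal.span {a}).finite_minimalPrimes_of_isNoetherianRing A).subset ?_)
    asIdeal_injective.injOn
  rintro _ ⟨P, hP, rfl⟩
  refine ⟨⟨P.isPrime, (Ideal.span_singleton_le_iff_mem _).mpr hP⟩, ?_⟩
  rintro q ⟨hq, haq⟩ hle
  refine (P.eq_asIdeal_of_le ?_ hle).ge
  rintro rfl
  exact ha (by simpa using haq)

variable [IsIntegrallyClosed A] (P : PrimeDivisor A)

@[simp]
theorem ord_zero : P.ord 0 = 0 := by simp [ord]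

theorem ord_zpow (f : FractionRing A) (n : ℤ) : P.ord (f ^ n) = n * P.ord f := by
  rw [ord, map_zpow₀, WithZero.log_zpow, smul_eq_mul, ord]

theorem ord_div {f g : FractionRing A} (hf : f ≠ 0) (hg : g ≠ 0) :
    P.ord (f / g) = P.ord f - P.ord g := by
  rw [div_eq_mul_inv, P.ord_mul hf (inv_ne_zero hg), P.ord_inv, sub_eq_add_neg]

theorem ord_smul {K : Type*} [Field K] [Algebra K A] {c : K} (hc : c ≠ 0) (f : FractionRing A) :
    P.ord (c • f) = P.ord f := by
  by_cases hf : f = 0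
  · rw [hf, smul_zero]
  have hc' : ι (algebraMap K A c) ≠ 0 := by
    rw [← IsScalarTower.algebraMap_apply]
    simpa using hc
  rw [Algebra.smul_def, IsScalarTower.algebraMap_apply K A, P.ord_mul hc' hf, P.ord_algebraMap hc,
    zero_add]

theorem ord_algebraMap_nonneg (a : A) : 0 ≤ P.ord (ι a) := by
  by_cases ha : a = 0
  · simp [ha]
  have ha' : algebraMap A P.LocalRing a ≠ 0 := by
    rwa [Ne, FaithfulSMul.algebraMap_eq_zero_iff]
  rw [IsScalarTower.algebraMap_apply A P.LocalRing (FractionRing A), ord,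
    WithZero.le_log_iff_exp_le (by simpa using ha)]
  simpa using Ring.ordFrac_ge_one_of_ne_zero (K := FractionRing A) ha'

theorem ord_algebraMap_eq_zero_iff {a : A} (ha : a ≠ 0) : P.ord (ι a) = 0 ↔ a ∉ P.asIdeal := by
  have hord : Ring.ordFrac P.LocalRing (algebraMap P.LocalRing (FractionRing A)
      (algebraMap A P.LocalRing a)) ≠ 0 := by simpa using ha
  rw [IsScalarTower.algebraMap_apply A P.LocalRing (FractionRing A), ord,
    ← Ideal.mem_primeCompl_iff, ← IsLocalization.AtPrime.isUnit_to_map_iff P.LocalRing P.asIdeal a,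
    Ring.isUnit_iff_ordFrac_one_of_isDiscreteValuationRing (K := FractionRing A),
    ← WithZero.exp_zero, ← WithZero.exp_log hord, WithZero.log_exp, WithZero.exp_inj]

theorem ord_algebraMap_pos_iff {a : A} (ha : a ≠ 0) : 0 < P.ord (ι a) ↔ a ∈ P.asIdeal := by
  rw [(P.ord_algebraMap_nonneg a).lt_iff_ne', Ne, P.ord_algebraMap_eq_zero_iff ha, not_not]

theorem exists_mul_eq_algebraMap {f : FractionRing A} (hf : 0 ≤ P.ord f) :
    ∃ s ∉ P.asIdeal, ∃ b : A, ι s * f = ι b := by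
  by_cases hf0 : f = 0
  · exact ⟨1, P.asIdeal.one_notMem, 0, by simp [hf0]⟩
  have hord : 1 ≤ Ring.ordFrac P.LocalRing f := by
    rw [ord, WithZero.le_log_iff_exp_le (by simpa)] at hf
    simpa using hf
  rw [Ring.ordFrac_eq_valuation_inv, one_le_inv₀ (by simpa [zero_lt_iff] using hf0)] at hord
  obtain ⟨x, hx⟩ := IsDiscreteValuationRing.exists_lift_of_le_one hord
  obtain ⟨b, s, rfl⟩ := IsLocalization.exists_mk'_eq P.asIdeal.primeCompl x
  refine ⟨s, s.2, b, ?_⟩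
  rw [← hx, IsScalarTower.algebraMap_apply A P.LocalRing (FractionRing A),
    IsScalarTower.algebraMap_apply A P.LocalRing (FractionRing A), ← map_mul,
    IsLocalization.mk'_spec']

theorem exists_ord_eq_one : ∃ a ∈ P.asIdeal, P.ord (ι a) = 1 := by
  obtain ⟨ϖ, hϖ⟩ := IsDiscreteValuationRing.exists_irreducible P.LocalRing
  obtain ⟨a, s, rfl⟩ := IsLocalization.exists_mk'_eq P.asIdeal.primeCompl ϖ
  have hord : P.ord (ι a) = 1 := by
    rw [IsScalarTower.algebraMap_apply A P.LocalRing (FractionRing A), ord,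
      ← IsLocalization.mk'_spec P.LocalRing a s, map_mul, map_mul, Ring.ordFrac_irreducible hϖ,
      Ring.ordFrac_of_isUnit (IsLocalization.map_units _ s), mul_one, WithZero.log_exp]
  have ha : a ≠ 0 := by
    rintro rfl
    simp at hord
  exact ⟨a, (P.ord_algebraMap_pos_iff ha).mp (by omega), hord⟩

theorem finite_setOf_ord_ne_zero (f : FractionRing A) :
    {P : PrimeDivisor A | P.ord f ≠ 0}.Finite := by
  obtain ⟨a, b, hb, rfl⟩ := IsFractionRing.div_surjective (A := A) f
  have hb0 : b ≠ 0 := nonZeroDivisors.ne_zero hb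
  by_cases ha : a = 0
  · simp [ha]
  refine ((finite_setOf_mem ha).union (finite_setOf_mem hb0)).subset fun P hP => ?_
  by_contra h
  simp only [Set.mem_union, Set.mem_ofPred_eq, not_or] at h
  apply hP
  rw [P.ord_div (by simpa using ha) (by simpa using hb0), (P.ord_algebraMap_eq_zero_iff ha).mpr h.1,
    (P.ord_algebraMap_eq_zero_iff hb0).mpr h.2, sub_zero]

/-- The `A`-module of rational functions of order at least `n` along `P`, including zero, whose
`ord` has the junk value `0`. -/
def filtration (n : ℤ) : Submodule A (FractionRing A) where
  carrier := {f | f ≠ 0 → n ≤ P.ord f}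
  zero_mem' := fun h => (h rfl).elim
  add_mem' := by
    intro f g hf hg hfg
    by_cases hf0 : f = 0
    · subst hf0
      rw [zero_add] at hfg ⊢
      exact hg hfg
    by_cases hg0 : g = 0
    · subst hg0
      rw [add_zero] at hfg ⊢
      exact hf hfg
    exact P.le_ord_add hf0 hg0 hfg (hf hf0) (hg hg0)
  smul_mem' := by
    intro a f hf haf
    rw [Algebra.smul_def] at haf ⊢
    rw [P.ord_mul (left_ne_zero_of_mul haf) (right_ne_zero_of_mul haf)]
    linarith [P.ord_algebraMap_nonneg a, hf (right_ne_zero_of_mul haf)]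

variable {P} in
theorem mem_filtration_iff {n : ℤ} {f : FractionRing A} (hf : f ≠ 0) :
    f ∈ P.filtration n ↔ n ≤ P.ord f :=
  ⟨fun h => h hf, fun h _ => h⟩

variable {P} in
theorem mul_mem_filtration {n m : ℤ} {f g : FractionRing A}
    (hf : f ∈ P.filtration n) (hg : g ∈ P.filtration m) : f * g ∈ P.filtration (n + m) := by
  intro h
  rw [P.ord_mul (left_ne_zero_of_mul h) (right_ne_zero_of_mul h)]
  exact add_le_add (hf (left_ne_zero_of_mul h)) (hg (right_ne_zero_of_mul h))

theorem algebraMap_mem_filtration_of_mem_pow {n : ℕ} {a : A} (ha : a ∈ P.asIdeal ^ n) :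
    ι a ∈ P.filtration n := by
  induction n generalizing a with
  | zero => exact fun _ => P.ord_algebraMap_nonneg a
  | succ n ih =>
    rw [pow_succ] at ha
    refine Submodule.mul_induction_on ha (fun b hb c hc => ?_) fun b c hb hc => ?_
    · rw [map_mul, Nat.cast_succ]
      refine mul_mem_filtration (ih hb) fun hc0 => ?_
      exact (P.ord_algebraMap_pos_iff (by simpa using hc0)).mpr hc
    · rw [map_add]
      exact add_mem hb hc

/-- The filtration by order is the filtration of `A` by the symbolic powers of the prime ideal. -/
theorem algebraMap_mem_filtration_iff {n : ℕ} {a : A} :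
    ι a ∈ P.filtration n ↔ ∃ s ∉ P.asIdeal, s * a ∈ P.asIdeal ^ n := by
  by_cases ha0 : a = 0
  · exact ⟨fun _ => ⟨1, P.asIdeal.one_notMem, by simp [ha0]⟩, fun _ => by simp [ha0]⟩
  have ha : ι a ≠ 0 := by simpa using ha0
  rw [mem_filtration_iff ha]
  constructor
  · intro hn
    obtain ⟨π, hπ, hπ1⟩ := P.exists_ord_eq_one
    have hπ0 : ι π ≠ 0 := fun h => by simp [h] at hπ1
    obtain ⟨s, hs, b, hb⟩ := P.exists_mul_eq_algebraMap (f := ι a / ι π ^ n) (by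
      rw [P.ord_div ha (pow_ne_zero _ hπ0), ← zpow_natCast, P.ord_zpow, hπ1]
      linarith)
    refine ⟨s, hs, ?_⟩
    have hsa : s * a = b * π ^ n := by
      apply FaithfulSMul.algebraMap_injective A (FractionRing A)
      rw [map_mul, map_mul, map_pow, ← hb]
      field_simp
    rw [hsa]
    exact Ideal.mul_mem_left _ _ (Ideal.pow_mem_pow hπ n)
  · rintro ⟨s, hs, hsa⟩
    have hs0 : s ≠ 0 := fun h => hs (h ▸ P.asIdeal.zero_mem)
    have h := P.algebraMap_mem_filtration_of_mem_pow hsa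
    rwa [map_mul, mem_filtration_iff (mul_ne_zero (by simpa using hs0) ha),
      P.ord_mul (by simpa using hs0) ha, (P.ord_algebraMap_eq_zero_iff hs0).mpr hs, zero_add] at h

theorem algebraMap_map_mem_filtration {θ : A →+* A} (hθ : P.asIdeal.comap θ = P.asIdeal) {n : ℕ}
    {a : A} (ha : ι a ∈ P.filtration n) : ι (θ a) ∈ P.filtration n := by
  rw [algebraMap_mem_filtration_iff] at ha ⊢
  obtain ⟨s, hs, hsa⟩ := ha
  refine ⟨θ s, fun h => hs ?_, ?_⟩
  · rwa [← hθ]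
  · rw [← map_mul]
    exact P.asIdeal.le_comap_pow θ n (by rwa [hθ])

end PrimeDivisor

section Hartogs

/-- The ideal of denominators of the rational function `f`. -/
def denominatorIdeal (f : FractionRing A) : Ideal A :=
  (Algebra.linearMap A (FractionRing A)).range.colon {f}

theorem mem_denominatorIdeal {f : FractionRing A} {a : A} :
    a ∈ denominatorIdeal f ↔ ∃ b, ι b = ι a * f := by
  rw [denominatorIdeal, Submodule.mem_colon_singleton, Algebra.smul_def]
  rfl

/-- The denominators of `f` annihilate its class in the quotient of the field of rational functions
by `A`, hence lie in an associated prime of that module. -/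
theorem exists_isPrime_denominatorIdeal [IsNoetherianRing A] {f : FractionRing A}
    (hf : f ∉ Set.range ι) :
    ∃ g : FractionRing A, (denominatorIdeal g).IsPrime ∧
      denominatorIdeal f ≤ denominatorIdeal g := by
  set N := (Algebra.linearMap A (FractionRing A)).range
  have hcolon : ∀ g, (⊥ : Submodule A (FractionRing A ⧸ N)).colon {N.mkQ g} =
      denominatorIdeal g := by
    intro g
    ext a
    rw [Submodule.mem_colon_singleton, ← map_smul, Submodule.mem_bot, Submodule.mkQ_apply,
      Submodule.Quotient.mk_eq_zero, denominatorIdeal, Submodule.mem_colon_singleton]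
  obtain ⟨p, hp, hle⟩ := exists_le_isAssociatedPrime_of_isNoetherianRing A (N.mkQ f) (by
    rwa [Ne, Submodule.mkQ_apply, Submodule.Quotient.mk_eq_zero])
  obtain ⟨hprime, x, rfl⟩ := isAssociatedPrime_iff.mp hp
  obtain ⟨g, rfl⟩ := N.mkQ_surjective x
  rw [hcolon] at hprime hle
  rw [hcolon] at hle
  exact ⟨g, hprime, hle⟩

variable [IsDomain A]

theorem denominatorIdeal_ne_bot (f : FractionRing A) : denominatorIdeal f ≠ ⊥ := by
  obtain ⟨a, b, hb, rfl⟩ := IsFractionRing.div_surjective (A := A) f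
  have hb0 : b ≠ 0 := nonZeroDivisors.ne_zero hb
  have hmem : b ∈ denominatorIdeal (ι a / ι b) :=
    mem_denominatorIdeal.mpr ⟨a, by rw [mul_div_cancel₀ _ (by simpa using hb0)]⟩
  exact fun h => hb0 (by simpa [h] using hmem)

variable [IsNoetherianRing A] [IsIntegrallyClosed A]

/-- Otherwise multiplication by `f` would preserve the finitely generated module
`denominatorIdeal f`, and `f` would be integral over `A`. -/
theorem exists_algebraMap_eq_mul_notMem {f : FractionRing A} (hf : f ∉ Set.range ι) :
    ∃ a ∈ denominatorIdeal f, ∃ u ∉ denominatorIdeal f, ι u = ι a * f := by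
  by_contra! hstable
  refine hf (IsIntegrallyClosed.isIntegral_iff.mp (isIntegral_of_smul_mem_submodule
    (Submodule.map (Algebra.linearMap A (FractionRing A)) (denominatorIdeal f)) ?_
    ((IsNoetherian.noetherian (denominatorIdeal f)).map _) f ?_))
  · rw [← Submodule.map_bot (Algebra.linearMap A (FractionRing A))]
    exact (Submodule.map_injective_of_injective
      (FaithfulSMul.algebraMap_injective A (FractionRing A))).ne (denominatorIdeal_ne_bot f)
  · rintro _ ⟨a, ha, rfl⟩
    obtain ⟨b, hb⟩ := mem_denominatorIdeal.mp ha
    refine ⟨b, ?_, by simp [hb, mul_comm]⟩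
    by_contra hbf
    exact hstable a ha b hbf hb

theorem height_denominatorIdeal {f : FractionRing A} (hf : (denominatorIdeal f).IsPrime) :
    (denominatorIdeal f).height = 1 := by
  have hfA : f ∉ Set.range ι := fun ⟨b, hb⟩ => hf.ne_top
    ((Ideal.eq_top_iff_one _).mpr (mem_denominatorIdeal.mpr ⟨b, by rw [hb, map_one, one_mul]⟩))
  obtain ⟨a, ha, u, hu, hua⟩ := exists_algebraMap_eq_mul_notMem hfA
  have hmin : denominatorIdeal f ∈ (Ideal.span {a}).minimalPrimes := by
    refine ⟨⟨hf, (Ideal.span_singleton_le_iff_mem _).mpr ha⟩, ?_⟩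
    rintro q ⟨hq, haq⟩ hle b hb
    obtain ⟨c, hc⟩ := mem_denominatorIdeal.mp hb
    have hub : u * b = a * c := by
      apply FaithfulSMul.algebraMap_injective A (FractionRing A)
      rw [map_mul, map_mul, hc, hua]
      ring
    refine (hq.mem_or_mem (x := u) (y := b) ?_).resolve_left fun huq => hu (hle huq)
    rw [hub]
    exact q.mul_mem_right _ ((Ideal.span_singleton_le_iff_mem _).mp haq)
  refine le_antisymm (Ideal.height_le_one_of_isPrincipal_of_mem_minimalPrimes _ _ hmin) ?_
  rw [Order.one_le_iff_ne_zero, Ne, Ideal.height_eq_zero_iff_eq_bot]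
  exact denominatorIdeal_ne_bot f

theorem mem_range_algebraMap_of_ord_nonneg {f : FractionRing A}
    (hf : ∀ P : PrimeDivisor A, 0 ≤ P.ord f) : f ∈ Set.range ι := by
  by_contra hfA
  obtain ⟨g, hprime, hle⟩ := exists_isPrime_denominatorIdeal hfA
  let P : PrimeDivisor A := ⟨⟨denominatorIdeal g, hprime⟩, height_denominatorIdeal hprime⟩
  obtain ⟨s, hs, b, hb⟩ := P.exists_mul_eq_algebraMap (hf P)
  exact hs (hle (mem_denominatorIdeal.mpr ⟨b, hb.symm⟩))

theorem exists_isUnit_algebraMap_eq {f : FractionRing A} (hf0 : f ≠ 0)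
    (hf : ∀ P : PrimeDivisor A, P.ord f = 0) : ∃ u : A, IsUnit u ∧ ι u = f := by
  obtain ⟨a, ha⟩ := mem_range_algebraMap_of_ord_nonneg fun P => (hf P).ge
  obtain ⟨b, hb⟩ := mem_range_algebraMap_of_ord_nonneg (f := f⁻¹) fun P => by
    rw [P.ord_inv, hf P, neg_zero]
  refine ⟨a, IsUnit.of_mul_eq_one b ?_, ha⟩
  apply FaithfulSMul.algebraMap_injective A (FractionRing A)
  rw [map_mul, ha, hb, map_one, mul_inv_cancel₀ hf0]

theorem exists_eq_smul_of_ord_eq {K : Type*} [Field K] [Algebra K A]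
    (hunits : ∀ u : A, IsUnit u → ∃ c : K, algebraMap K A c = u)
    {f g : FractionRing A} (hf : f ≠ 0) (hg : g ≠ 0)
    (h : ∀ P : PrimeDivisor A, P.ord f = P.ord g) : ∃ c : K, f = c • g := by
  obtain ⟨u, hu, huf⟩ := exists_isUnit_algebraMap_eq (div_ne_zero hf hg) fun P => by
    rw [P.ord_div hf hg, h, sub_self]
  obtain ⟨c, rfl⟩ := hunits u hu
  exact ⟨c, by rw [Algebra.smul_def, IsScalarTower.algebraMap_apply K A, huf,
    div_mul_cancel₀ _ hg]⟩

end Hartogs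

variable [IsDomain A] [IsNoetherianRing A] [IsIntegrallyClosed A]

/-- The divisor of the rational function `f`, with junk value `0` at `f = 0`. -/
def divisorOf (f : FractionRing A) : WeilDivisor A :=
  Finsupp.ofSupportFinite (fun P => P.ord f) (PrimeDivisor.finite_setOf_ord_ne_zero f)

@[simp]
theorem divisorOf_apply (f : FractionRing A) (P : PrimeDivisor A) : divisorOf f P = P.ord f := rfl

theorem isDivisorOf_iff {f : FractionRing A} (hf : f ≠ 0) {D : WeilDivisor A} :
    IsDivisorOf f D ↔ divisorOf f = D :=
  ⟨fun h => Finsupp.ext fun P => (h.2 P).symm, fun h => ⟨hf, fun P => by rw [← h]; rfl⟩⟩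

theorem divisorClass_eq_iff {D D' : WeilDivisor A} :
    divisorClass D = divisorClass D' ↔ ∃ f : FractionRing A, f ≠ 0 ∧ divisorOf f = D - D' := by
  rw [divisorClass, divisorClass, QuotientAddGroup.eq_iff_sub_mem]
  exact exists_congr fun f =>
    ⟨fun h => ⟨h.1, (isDivisorOf_iff h.1).mp h⟩, fun h => (isDivisorOf_iff h.1).mpr h.2⟩

end Divisors

/-! ### Semi-invariant functions and the open orbit -/

section TorusCharacter

variable {K : Type*} [Field K] {r : ℕ}

theorem torusCharacter_mul (m : Fin r → ℤ) (s t : Fin r → Kˣ) :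
    torusCharacter m (s * t) = torusCharacter m s * torusCharacter m t := by
  simp [torusCharacter, mul_zpow, Finset.prod_mul_distrib]

theorem torusCharacter_add (m n : Fin r → ℤ) (t : Fin r → Kˣ) :
    torusCharacter (m + n) t = torusCharacter m t * torusCharacter n t := by
  simp [torusCharacter, zpow_add, Finset.prod_mul_distrib]

@[simp]
theorem torusCharacter_zero (t : Fin r → Kˣ) : torusCharacter 0 t = 1 := by
  simp [torusCharacter]

@[simp]
theorem torusCharacter_one (m : Fin r → ℤ) : torusCharacter m (1 : Fin r → Kˣ) = 1 := by
  simp [torusCharacter]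

theorem torusCharacter_mulSingle (m : Fin r → ℤ) (i : Fin r) (u : Kˣ) :
    torusCharacter m (Pi.mulSingle i u) = u ^ m i := by
  rw [torusCharacter, Finset.prod_eq_single i]
  · simp
  · intro j _ hj
    simp [Pi.mulSingle_eq_of_ne hj]
  · simp

theorem torusCharacter_of_hom (φ : Multiplicative (Fin r → ℤ) →* Kˣ) (m : Fin r → ℤ) :
    torusCharacter m (fun i => φ (.ofAdd (Pi.single i 1))) = φ (.ofAdd m) := by
  conv_rhs => rw [← Finset.univ_sum_single m, ofAdd_sum, map_prod]
  refine Finset.prod_congr rfl fun i _ => ?_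
  rw [← map_zpow, ← ofAdd_zsmul, ← Pi.single_smul, smul_eq_mul, mul_one]

/-- The character `χᵐ` as a multiplicative map into the base field, the form in which Dedekind's
independence of characters applies to it. -/
def torusCharacterHom (K : Type*) [Field K] (m : Fin r → ℤ) : (Fin r → Kˣ) →* K where
  toFun t := torusCharacter m t
  map_one' := by simp
  map_mul' s t := by rw [torusCharacter_mul, Units.val_mul]

theorem torusCharacterHom_injective [CharZero K] :
    Function.Injective (torusCharacterHom K : (Fin r → ℤ) → ((Fin r → Kˣ) →* K)) := by
  intro m n h
  funext i
  have hi : ((2 : K) ^ m i) = 2 ^ n i := by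
    simpa [torusCharacterHom, torusCharacter_mulSingle] using
      DFunLike.congr_fun h (Pi.mulSingle i (Units.mk0 (2 : K) two_ne_zero))
  have hi' : ((2 : ℚ) ^ m i) = 2 ^ n i := Rat.cast_injective (α := K) (by simpa using hi)
  exact zpow_right_injective₀ (by norm_num) (by norm_num) hi'

theorem eq_zero_of_sum_torusCharacter_smul_eq_zero [CharZero K] {V : Type*} [AddCommGroup V]
    [Module K V] {F : Finset (Fin r → ℤ)} {b : (Fin r → ℤ) → V}
    (h : ∀ t : Fin r → Kˣ, ∑ m ∈ F, (torusCharacter m t : K) • b m = 0) :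
    ∀ m ∈ F, b m = 0 := by
  intro m hm
  rw [← Module.forall_dual_apply_eq_zero_iff K]
  intro φ
  have hli := (linearIndependent_monoidHom (Fin r → Kˣ) K).comp _
    (torusCharacterHom_injective (K := K) (r := r))
  refine linearIndependent_iff'.mp hli F (fun m => φ (b m)) ?_ m hm
  funext t
  simpa [torusCharacterHom, mul_comm] using congrArg φ (h t)

theorem finite_of_isSimpleModule_int (M : Type*) [AddCommGroup M] [IsSimpleModule ℤ M] :
    Finite M := by
  obtain ⟨I, hI, ⟨e⟩⟩ := isSimpleModule_iff_quot_maximal.mp ‹IsSimpleModule ℤ M›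
  have : Finite (ℤ ⧸ I) := Ideal.finiteQuotientOfFreeOfNeBot I
    (Ring.ne_bot_of_isMaximal_of_not_isField hI Int.not_isField)
  exact .of_equiv _ e.symm.toEquiv

theorem exists_torusCharacter_eq_one [IsAlgClosed K] [CharZero K] {G : AddSubgroup (Fin r → ℤ)}
    (hG : G ≠ ⊤) : ∃ t : Fin r → Kˣ, t ≠ 1 ∧ ∀ m ∈ G, torusCharacter m t = 1 := by
  obtain ⟨N, hN, hGN⟩ := (eq_top_or_exists_le_coatom (AddSubgroup.toIntSubmodule G)).resolve_left
    (by simpa using hG)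
  have := isSimpleModule_iff_isCoatom.mpr hN
  have := finite_of_isSimpleModule_int ((Fin r → ℤ) ⧸ N)
  obtain ⟨m, -, hm⟩ := SetLike.exists_of_lt hN.lt_top
  have : NeZero (Monoid.exponent (Multiplicative ((Fin r → ℤ) ⧸ N))) :=
    ⟨Monoid.exponent_ne_zero_of_finite⟩
  obtain ⟨φ, hφ⟩ := CommGroup.exists_apply_ne_one_of_hasEnoughRootsOfUnity
    (Multiplicative ((Fin r → ℤ) ⧸ N)) K (a := .ofAdd (N.mkQ m)) (by simpa using hm)
  have key := torusCharacter_of_hom (φ.comp N.mkQ.toAddMonoidHom.toMultiplicative)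
  refine ⟨_, fun h => hφ ?_, fun n hn => (key n).trans ?_⟩
  · exact (key m).symm.trans (by rw [h, torusCharacter_one])
  · have hn0 : N.mkQ n = 0 := by simpa using hGN hn
    simp [hn0]

end TorusCharacter

namespace TorusAction

section Weights

variable {K : Type*} [Field K] {r : ℕ} {A : Type*} [CommRing A] [Algebra K A]
variable {T : TorusAction K r A} {k l m n : Fin r → ℤ} {a b : A}

theorem IsWeightVector.add (ha : T.IsWeightVector m a) (hb : T.IsWeightVector m b) :
    T.IsWeightVector m (a + b) := fun t => by
  rw [map_add, ha t, hb t, smul_add]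

theorem IsWeightVector.smul (c : K) (ha : T.IsWeightVector m a) :
    T.IsWeightVector m (c • a) := fun t => by
  rw [map_smul, ha t, smul_comm]

theorem IsWeightVector.sub (ha : T.IsWeightVector m a) (hb : T.IsWeightVector m b) :
    T.IsWeightVector m (a - b) := fun t => by
  rw [map_sub, ha t, hb t, smul_sub]

theorem IsWeightVector.mul (ha : T.IsWeightVector m a) (hb : T.IsWeightVector n b) :
    T.IsWeightVector (m + n) (a * b) := fun t => by
  rw [map_mul, ha t, hb t, torusCharacter_add, Units.val_mul, smul_mul_smul_comm]

theorem isWeightVector_one : T.IsWeightVector 0 1 := fun t => by simp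

theorem act_sum {F : Finset (Fin r → ℤ)} {b : (Fin r → ℤ) → A}
    (hb : ∀ m ∈ F, T.IsWeightVector m (b m)) (t : Fin r → Kˣ) :
    T.act t (∑ m ∈ F, b m) = ∑ m ∈ F, (torusCharacter m t : K) • b m := by
  rw [map_sum]
  exact Finset.sum_congr rfl fun m hm => hb m hm t

theorem exists_weight_decomposition [CharZero K] (T : TorusAction K r A) (a : A) :
    ∃ (F : Finset (Fin r → ℤ)) (b : (Fin r → ℤ) → A),
      (∀ m ∈ F, T.IsWeightVector m (b m)) ∧ a = ∑ m ∈ F, b m := by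
  obtain ⟨p, hp⟩ := T.regular a
  refine ⟨p.support, p, fun m hm s => ?_, by simpa [Finsupp.sum] using hp 1⟩
  rw [← sub_eq_zero]
  refine eq_zero_of_sum_torusCharacter_smul_eq_zero (K := K)
    (b := fun m => T.act s (p m) - (torusCharacter m s : K) • p m) (fun t => ?_) m hm
  have hst : T.act (s * t) a = T.act s (T.act t a) := by rw [map_mul]; rfl
  simp only [hp, Finsupp.sum, map_sum, map_smul, torusCharacter_mul, Units.val_mul] at hst
  simp only [smul_sub, Finset.sum_sub_distrib, smul_smul, mul_comm (torusCharacter _ t : K), hst,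
    sub_self]

theorem mem_of_sum_mem [CharZero K] {V : Submodule K A} (hV : ∀ t, ∀ a ∈ V, T.act t a ∈ V)
    {F : Finset (Fin r → ℤ)} {b : (Fin r → ℤ) → A} (hb : ∀ m ∈ F, T.IsWeightVector m (b m))
    (h : ∑ m ∈ F, b m ∈ V) : ∀ m ∈ F, b m ∈ V := by
  intro m hm
  rw [← Submodule.Quotient.mk_eq_zero]
  refine eq_zero_of_sum_torusCharacter_smul_eq_zero (K := K) (b := fun m => V.mkQ (b m))
    (fun t => ?_) m hm
  have ht : V.mkQ (T.act t (∑ m ∈ F, b m)) = 0 :=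
    (Submodule.Quotient.mk_eq_zero V).mpr (hV t _ h)
  simpa [act_sum hb] using ht

theorem closure_weights_eq_top [IsAlgClosed K] [CharZero K] (hT : T.Effective) :
    AddSubgroup.closure {m | ∃ a ≠ 0, T.IsWeightVector m a} = ⊤ := by
  by_contra h
  obtain ⟨t, ht1, ht⟩ := exists_torusCharacter_eq_one (K := K) h
  refine ht1 (hT ?_)
  rw [map_one]
  ext a
  obtain ⟨F, b, hb, rfl⟩ := T.exists_weight_decomposition a
  rw [act_sum hb, AlgEquiv.one_apply]
  refine Finset.sum_congr rfl fun m hm => ?_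
  by_cases hbm : b m = 0
  · rw [hbm, smul_zero]
  · rw [ht m (AddSubgroup.subset_closure ⟨b m, hbm, hb m hm⟩), Units.val_one, one_smul]

theorem eq_zero_of_mem_of_isOpen_orbit [IsDomain A] [IsJacobsonRing A] {x : MaximalSpectrum A}
    (hx : IsOpen (T.orbit x)) (ha : T.IsWeightVector m a) (hax : a ∈ x.asIdeal) : a = 0 := by
  refine eq_zero_of_isOpen_of_forall_mem hx ⟨x, 1, by rw [map_one]; rfl⟩ ?_
  rintro y ⟨t, hy⟩
  rw [hy]
  change T.act t a ∈ x.asIdeal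
  rw [ha t, Algebra.smul_def]
  exact Ideal.mul_mem_left _ _ hax

theorem exists_eq_smul_of_isWeightVector [IsAlgClosed K] [IsDomain A] [Algebra.FiniteType K A]
    (hT : T.LocallyTransitive) (ha : T.IsWeightVector m a) (hb : T.IsWeightVector m b)
    (hb0 : b ≠ 0) : ∃ c : K, a = c • b := by
  have : IsJacobsonRing A := isJacobsonRing_of_finiteType (A := K)
  obtain ⟨x, hx⟩ := hT
  have := x.isMaximal
  obtain ⟨c, hc⟩ := exists_sub_smul_mem K x.asIdeal a
    fun h => hb0 (eq_zero_of_mem_of_isOpen_orbit hx hb h)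
  exact ⟨c, sub_eq_zero.mp (eq_zero_of_mem_of_isOpen_orbit hx (ha.sub (hb.smul c)) hc)⟩

end Weights

section SemiInvariant

variable {K : Type*} [Field K] {r : ℕ} {A : Type*} [CommRing A] [IsDomain A] [Algebra K A]
variable (T : TorusAction K r A) {m n : Fin r → ℤ}

local notation "ι" => algebraMap A (FractionRing A)

/-- The nonzero rational functions which are semi-invariant of weight `m`, encoded as the quotients
of semi-invariant regular functions whose weights differ by `m`. -/
def IsSemiInvariant (m : Fin r → ℤ) (f : FractionRing A) : Prop :=
  ∃ k l : Fin r → ℤ, k - l = m ∧ ∃ a ≠ 0, ∃ b ≠ 0,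
    T.IsWeightVector k a ∧ T.IsWeightVector l b ∧ f = ι a / ι b

variable {T} {f g : FractionRing A}

theorem IsWeightVector.isSemiInvariant {a : A} (ha : T.IsWeightVector m a) (ha0 : a ≠ 0) :
    T.IsSemiInvariant m (ι a) :=
  ⟨m, 0, sub_zero m, a, ha0, 1, one_ne_zero, ha, isWeightVector_one, by rw [map_one, div_one]⟩

namespace IsSemiInvariant

theorem one : T.IsSemiInvariant 0 1 := by
  simpa using isWeightVector_one.isSemiInvariant (T := T) one_ne_zero

theorem ne_zero (hf : T.IsSemiInvariant m f) : f ≠ 0 := by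
  obtain ⟨k, l, -, a, ha0, b, hb0, -, -, rfl⟩ := hf
  simpa using ⟨ha0, hb0⟩

theorem mul (hf : T.IsSemiInvariant m f) (hg : T.IsSemiInvariant n g) :
    T.IsSemiInvariant (m + n) (f * g) := by
  obtain ⟨k, l, rfl, a, ha0, b, hb0, ha, hb, rfl⟩ := hf
  obtain ⟨k', l', rfl, a', ha0', b', hb0', ha', hb', rfl⟩ := hg
  exact ⟨k + k', l + l', add_sub_add_comm _ _ _ _, a * a', mul_ne_zero ha0 ha0', b * b',
    mul_ne_zero hb0 hb0', ha.mul ha', hb.mul hb', by rw [map_mul, map_mul, div_mul_div_comm]⟩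

theorem inv (hf : T.IsSemiInvariant m f) : T.IsSemiInvariant (-m) f⁻¹ := by
  obtain ⟨k, l, rfl, a, ha0, b, hb0, ha, hb, rfl⟩ := hf
  exact ⟨l, k, (neg_sub k l).symm, b, hb0, a, ha0, hb, ha, inv_div _ _⟩

theorem zpow (hf : T.IsSemiInvariant m f) (n : ℤ) : T.IsSemiInvariant (n • m) (f ^ n) := by
  induction n with
  | zero => simpa using one
  | succ n ih => simpa [add_smul, zpow_add_one₀ hf.ne_zero] using ih.mul hf
  | pred n ih =>
    rw [sub_smul, one_smul, sub_eq_add_neg, zpow_sub_one₀ hf.ne_zero]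
    exact ih.mul hf.inv

theorem prod {I : Type*} {w : I → Fin r → ℤ} {f : I → FractionRing A} {s : Finset I}
    (hf : ∀ i ∈ s, T.IsSemiInvariant (w i) (f i)) :
    T.IsSemiInvariant (∑ i ∈ s, w i) (∏ i ∈ s, f i) := by
  classical
  induction s using Finset.induction_on with
  | empty => simpa using one
  | insert i s hi ih =>
    rw [Finset.sum_insert hi, Finset.prod_insert hi]
    exact (hf i (Finset.mem_insert_self i s)).mul
      (ih fun j hj => hf j (Finset.mem_insert_of_mem hj))

theorem isWeightVector {a : A} (ha : T.IsSemiInvariant m (ι a)) : T.IsWeightVector m a := by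
  obtain ⟨k, l, rfl, b, -, d, hd0, hb, hd, h⟩ := ha
  rw [eq_div_iff (by simpa using hd0), ← map_mul] at h
  obtain rfl := IsFractionRing.injective A (FractionRing A) h
  intro t
  have hχ : (torusCharacter k t : K) = torusCharacter (k - l) t * torusCharacter l t := by
    rw [← Units.val_mul, ← torusCharacter_add, sub_add_cancel]
  have htd : T.act t d ≠ 0 := by simpa using hd0
  refine mul_right_cancel₀ htd ?_
  rw [← map_mul, hb t, hd t, smul_mul_smul_comm, hχ]

theorem exists_eq_smul [IsAlgClosed K] [Algebra.FiniteType K A] (hT : T.LocallyTransitive)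
    (hf : T.IsSemiInvariant m f) {a : A} (ha : T.IsWeightVector m a) : ∃ c : K, ι a = c • f := by
  obtain ⟨k, l, rfl, b, hb0, d, hd0, hb, hd, rfl⟩ := hf
  obtain ⟨c, hc⟩ := exists_eq_smul_of_isWeightVector hT
    (by simpa using ha.mul hd) hb hb0
  refine ⟨c, ?_⟩
  rw [← smul_div_assoc, eq_div_iff (by simpa using hd0), ← map_mul, hc, Algebra.smul_def,
    Algebra.smul_def, map_mul, ← IsScalarTower.algebraMap_apply]

end IsSemiInvariant

theorem exists_isSemiInvariant [IsAlgClosed K] [CharZero K] (hT : T.Effective) (m : Fin r → ℤ) :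
    ∃ f, T.IsSemiInvariant m f := by
  have hm : m ∈ AddSubgroup.closure {m | ∃ a ≠ 0, T.IsWeightVector m a} :=
    closure_weights_eq_top hT ▸ AddSubgroup.mem_top m
  induction hm using AddSubgroup.closure_induction with
  | mem m h => exact let ⟨a, ha0, ha⟩ := h; ⟨ι a, ha.isSemiInvariant ha0⟩
  | zero => exact ⟨1, .one⟩
  | add m n _ _ ihm ihn => exact let ⟨f, hf⟩ := ihm; let ⟨g, hg⟩ := ihn; ⟨f * g, hf.mul hg⟩
  | neg m _ ihm => exact let ⟨f, hf⟩ := ihm; ⟨f⁻¹, hf.inv⟩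

variable (T) in
/-- A multiplicative choice of rational functions `χᵐ` spanning the spaces of semi-invariants, that
is, an identification of the open orbit with the torus. -/
structure CharacterSystem where
  χ : (Fin r → ℤ) → FractionRing A
  add : ∀ m n, χ (m + n) = χ m * χ n
  isSemiInvariant : ∀ m, T.IsSemiInvariant m (χ m)
  exists_eq_smul : ∀ {m a}, T.IsWeightVector m a → ∃ c : K, ι a = c • χ m

theorem nonempty_characterSystem [IsAlgClosed K] [CharZero K] [Algebra.FiniteType K A]
    (hT : T.LocallyTransitive) (hTeff : T.Effective) : Nonempty T.CharacterSystem := by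
  choose f hf using fun i : Fin r => exists_isSemiInvariant hTeff (Pi.single i 1)
  have hχ : ∀ m : Fin r → ℤ, T.IsSemiInvariant m (∏ i, f i ^ m i) := fun m => by
    have h := IsSemiInvariant.prod (s := .univ) fun i _ => (hf i).zpow (m i)
    simp only [← Pi.single_smul, smul_eq_mul, mul_one] at h
    rwa [Finset.univ_sum_single] at h
  refine ⟨⟨fun m => ∏ i, f i ^ m i, fun m n => ?_, hχ, fun ha => (hχ _).exists_eq_smul hT ha⟩⟩
  rw [← Finset.prod_mul_distrib]
  exact Finset.prod_congr rfl fun i _ => zpow_add₀ (hf i).ne_zero _ _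

end SemiInvariant

end TorusAction

namespace TorusAction.CharacterSystem

section OpenOrbit

open AddMonoidAlgebra

variable {K : Type*} [Field K] {r : ℕ} {A : Type*} [CommRing A] [IsDomain A] [Algebra K A]
variable {T : TorusAction K r A} (X : T.CharacterSystem) {m : Fin r → ℤ} {a : A}

local notation "ι" => algebraMap A (FractionRing A)

theorem ne_zero (m : Fin r → ℤ) : X.χ m ≠ 0 := (X.isSemiInvariant m).ne_zero

theorem χ_zero : X.χ 0 = 1 :=
  (mul_eq_left₀ (X.ne_zero 0)).mp (by rw [← X.add, add_zero])

theorem ne_zero_of_eq (ha : ι a = X.χ m) : a ≠ 0 := by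
  rintro rfl
  exact X.ne_zero m (by rw [← ha, map_zero])

theorem isWeightVector (ha : ι a = X.χ m) : T.IsWeightVector m a :=
  IsSemiInvariant.isWeightVector (by simpa only [ha] using X.isSemiInvariant m)

/-- The weight semigroup: those `m` for which the rational function `χᵐ` is regular on `X`. -/
def regular : AddSubmonoid (Fin r → ℤ) where
  carrier := {m | ∃ a : A, ι a = X.χ m}
  zero_mem' := ⟨1, by rw [X.χ_zero, map_one]⟩
  add_mem' := by
    rintro m n ⟨a, ha⟩ ⟨b, hb⟩
    exact ⟨a * b, by rw [map_mul, ha, hb, X.add]⟩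

theorem exists_mem_of_smul_mem {V : Submodule K A} {c : K} (hc : c ≠ 0) (ha : ι a = c • X.χ m)
    (haV : a ∈ V) : ∃ e ∈ V, ι e = X.χ m :=
  ⟨c⁻¹ • a, V.smul_mem _ haV, by
    rw [algebraMap.smul, ha, inv_smul_smul₀ hc]⟩

theorem mem_regular_of_isWeightVector (ha0 : a ≠ 0) (ha : T.IsWeightVector m a) :
    m ∈ X.regular := by
  obtain ⟨c, hc⟩ := X.exists_eq_smul ha
  have hc0 : c ≠ 0 := by
    rintro rfl
    exact ha0 (by simpa using hc)
  obtain ⟨e, -, he⟩ := X.exists_mem_of_smul_mem (V := ⊤) hc0 hc trivial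
  exact ⟨e, he⟩

theorem exists_shift (F : Finset (Fin r → ℤ)) :
    ∃ s ∈ X.regular, ∀ m ∈ F, m + s ∈ X.regular := by
  induction F using Finset.cons_induction with
  | empty => exact ⟨0, zero_mem _, by simp⟩
  | cons m F hm ih =>
    obtain ⟨s, hs, hF⟩ := ih
    obtain ⟨k, l, rfl, a, ha0, b, hb0, ha, hb, -⟩ := X.isSemiInvariant m
    have hk := X.mem_regular_of_isWeightVector ha0 ha
    have hl := X.mem_regular_of_isWeightVector hb0 hb
    refine ⟨s + l, add_mem hs hl, fun n hn => ?_⟩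
    obtain rfl | hn := Finset.mem_cons.mp hn
    · rw [add_comm s l, ← add_assoc, sub_add_cancel]
      exact add_mem hk hs
    · rw [← add_assoc]
      exact add_mem (hF n hn) hl

/-- Laurent polynomials as rational functions on `X`, the isomorphism of the torus with the open
orbit. -/
def ofLaurent : K[Fin r → ℤ] →ₐ[K] FractionRing A :=
  AddMonoidAlgebra.lift K _ _
    { toFun := fun m => X.χ m.toAdd
      map_one' := X.χ_zero
      map_mul' := fun m n => X.add m.toAdd n.toAdd }

@[simp]
theorem ofLaurent_single (m : Fin r → ℤ) (c : K) : X.ofLaurent (single m c) = c • X.χ m :=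
  lift_single ..

theorem ofLaurent_apply (p : K[Fin r → ℤ]) :
    X.ofLaurent p = ∑ m ∈ p.coeff.support, p.coeff m • X.χ m :=
  lift_apply ..

theorem algebraMap_sum_smul {p : K[Fin r → ℤ]} {s : Fin r → ℤ} {a : (Fin r → ℤ) → A}
    (ha : ∀ m ∈ p.coeff.support, ι (a m) = X.χ (m + s)) :
    ι (∑ m ∈ p.coeff.support, p.coeff m • a m) = X.ofLaurent p * X.χ s := by
  rw [ofLaurent_apply, Finset.sum_mul, map_sum]
  refine Finset.sum_congr rfl fun m hm => ?_
  rw [algebraMap.smul, ha m hm, X.add, smul_mul_assoc]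

variable [CharZero K]

theorem ofLaurent_injective : Function.Injective X.ofLaurent := by
  refine (injective_iff_map_eq_zero _).mpr fun p hp => ?_
  obtain ⟨s, -, hs⟩ := X.exists_shift p.coeff.support
  choose! a ha using hs
  have hsum : ∑ m ∈ p.coeff.support, p.coeff m • a m = 0 := by
    apply IsFractionRing.injective A (FractionRing A)
    rw [X.algebraMap_sum_smul ha, hp, zero_mul, map_zero]
  have hact : ∀ t : Fin r → Kˣ,
      ∑ m ∈ p.coeff.support, (torusCharacter m t : K) • p.coeff m • a m = 0 := by
    intro t
    have h : (torusCharacter s t : K) •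
        ∑ m ∈ p.coeff.support, (torusCharacter m t : K) • p.coeff m • a m = 0 := by
      rw [← map_zero (T.act t), ← hsum, map_sum, Finset.smul_sum]
      refine Finset.sum_congr rfl fun m hm => ?_
      rw [map_smul, X.isWeightVector (ha m hm) t, add_comm m s, torusCharacter_add, Units.val_mul,
        smul_comm (p.coeff m), mul_smul]
    exact (smul_eq_zero.mp h).resolve_left (Units.ne_zero _)
  ext m
  by_contra hm
  have hm' := Finsupp.mem_support_iff.mpr hm
  have h := eq_zero_of_sum_torusCharacter_smul_eq_zero (K := K) hact m hm'
  exact (smul_ne_zero hm (X.ne_zero_of_eq (ha m hm'))) h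

theorem linearIndependent_χ : LinearIndependent K X.χ := by
  have hχ : X.χ = X.ofLaurent.toLinearMap ∘ AddMonoidAlgebra.basis (Fin r → ℤ) K :=
    funext fun m => by simp
  rw [hχ]
  exact (AddMonoidAlgebra.basis (Fin r → ℤ) K).linearIndependent.map' X.ofLaurent.toLinearMap
    (LinearMap.ker_eq_bot.mpr X.ofLaurent_injective)

theorem exists_ofLaurent_eq {V : Submodule K A} (hV : ∀ t, ∀ a ∈ V, T.act t a ∈ V) (ha : a ∈ V) :
    ∃ p, X.ofLaurent p = ι a ∧ ∀ m, p.coeff m ≠ 0 → ∃ e ∈ V, ι e = X.χ m := by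
  obtain ⟨F, b, hb, rfl⟩ := T.exists_weight_decomposition a
  have hbV := mem_of_sum_mem hV hb ha
  choose! c hc using fun m (hm : m ∈ F) => X.exists_eq_smul (hb m hm)
  refine ⟨∑ m ∈ F, single m (c m), ?_, fun m hm => ?_⟩
  · rw [map_sum, map_sum]
    exact Finset.sum_congr rfl fun m hm => by rw [ofLaurent_single, hc m hm]
  · simp only [coeff_sum, coeff_single, Finsupp.finsetSum_apply, Finsupp.single_apply,
      Finset.sum_ite_eq', ne_eq, ite_eq_right_iff, Classical.not_imp] at hm
    exact X.exists_mem_of_smul_mem hm.2 (hc m hm.1) (hbV m hm.1)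

/-- The Laurent expansion of a regular function, its restriction to the open orbit. -/
def toLaurent : A →ₐ[K] K[Fin r → ℤ] :=
  (AlgEquiv.ofInjective X.ofLaurent X.ofLaurent_injective).symm.toAlgHom.comp <|
    (IsScalarTower.toAlgHom K A (FractionRing A)).codRestrict X.ofLaurent.range fun a =>
      let ⟨p, hp, _⟩ := X.exists_ofLaurent_eq (V := ⊤) (fun _ _ _ => trivial) (a := a) trivial
      ⟨p, hp⟩

@[simp]
theorem ofLaurent_toLaurent (a : A) : X.ofLaurent (X.toLaurent a) = ι a :=
  congrArg Subtype.val ((AlgEquiv.ofInjective X.ofLaurent X.ofLaurent_injective).apply_symm_apply _)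

theorem toLaurent_eq_iff {p : K[Fin r → ℤ]} : X.toLaurent a = p ↔ ι a = X.ofLaurent p := by
  rw [← X.ofLaurent_injective.eq_iff, ofLaurent_toLaurent]

theorem toLaurent_injective : Function.Injective X.toLaurent := fun a b h =>
  IsFractionRing.injective A (FractionRing A) (by simpa [toLaurent_eq_iff] using h)

theorem exists_mem_of_coeff_toLaurent_ne_zero {V : Submodule K A}
    (hV : ∀ t, ∀ a ∈ V, T.act t a ∈ V) (ha : a ∈ V) (hm : (X.toLaurent a).coeff m ≠ 0) :
    ∃ e ∈ V, ι e = X.χ m := by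
  obtain ⟨p, hp, hpV⟩ := X.exists_ofLaurent_eq hV ha
  rw [X.toLaurent_eq_iff.mpr hp.symm] at hm
  exact hpV m hm

theorem mem_regular_of_coeff_toLaurent_ne_zero (hm : (X.toLaurent a).coeff m ≠ 0) :
    m ∈ X.regular := by
  obtain ⟨e, -, he⟩ := X.exists_mem_of_coeff_toLaurent_ne_zero (V := ⊤)
    (fun _ _ _ => trivial) trivial hm
  exact ⟨e, he⟩

theorem exists_toLaurent_eq_mul_single (p : K[Fin r → ℤ]) :
    ∃ s a, X.toLaurent a = p * single s 1 := by
  obtain ⟨s, -, hs⟩ := X.exists_shift p.coeff.support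
  choose! a ha using hs
  refine ⟨s, ∑ m ∈ p.coeff.support, p.coeff m • a m, X.toLaurent_eq_iff.mpr ?_⟩
  rw [X.algebraMap_sum_smul ha, map_mul, ofLaurent_single, one_smul]

end OpenOrbit

end TorusAction.CharacterSystem

/-! ### Invariant prime divisors -/

namespace TorusAction.CharacterSystem

section Valuation

open AddMonoidAlgebra

variable {K : Type*} [Field K] {r : ℕ} {A : Type*} [CommRing A] [IsDomain A] [Algebra K A]
variable [IsNoetherianRing A] [IsIntegrallyClosed A]
variable {T : TorusAction K r A} (X : T.CharacterSystem) {m : Fin r → ℤ} {a : A}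
variable {P Q : PrimeDivisor A}

local notation "ι" => algebraMap A (FractionRing A)

/-- The order of vanishing of the characters along a prime divisor, as a linear form on `M`; for an
invariant prime divisor it is the primitive generator of the corresponding ray. -/
def val (P : PrimeDivisor A) : (Fin r → ℤ) →+ ℤ where
  toFun m := P.ord (X.χ m)
  map_zero' := by rw [X.χ_zero, P.ord_one]
  map_add' m n := by rw [X.add, P.ord_mul (X.ne_zero m) (X.ne_zero n)]

theorem val_apply (P : PrimeDivisor A) (m : Fin r → ℤ) : X.val P m = P.ord (X.χ m) := rfl

theorem val_nonneg (P : PrimeDivisor A) (hm : m ∈ X.regular) : 0 ≤ X.val P m := by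
  obtain ⟨a, ha⟩ := hm
  rw [val_apply, ← ha]
  exact P.ord_algebraMap_nonneg a

theorem val_pos_iff (ha : ι a = X.χ m) : 0 < X.val P m ↔ a ∈ P.asIdeal := by
  rw [val_apply, ← ha]
  exact P.ord_algebraMap_pos_iff (X.ne_zero_of_eq ha)

theorem ofLaurent_mem_filtration {n : ℤ} {p : K[Fin r → ℤ]}
    (h : ∀ m, p.coeff m ≠ 0 → n ≤ X.val P m) : X.ofLaurent p ∈ P.filtration n := by
  rw [ofLaurent_apply]
  refine sum_mem fun m hm => ?_
  rw [← algebraMap_smul A]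
  exact Submodule.smul_mem _ _ ((P.mem_filtration_iff (X.ne_zero m)).mpr
    (h m (Finsupp.mem_support_iff.mp hm)))

variable [CharZero K]

theorem mem_of_forall_val_pos (h : ∀ m, (X.toLaurent a).coeff m ≠ 0 → 0 < X.val P m) :
    a ∈ P.asIdeal := by
  obtain rfl | ha0 := eq_or_ne a 0
  · exact zero_mem _
  have hmem := X.ofLaurent_mem_filtration (n := 1) h
  rw [ofLaurent_toLaurent, P.mem_filtration_iff (by simpa using ha0)] at hmem
  exact (P.ord_algebraMap_pos_iff ha0).mp hmem

theorem ord_le_val (hP : T.Invariant P) (ha0 : a ≠ 0) (hm : (X.toLaurent a).coeff m ≠ 0) :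
    P.ord (ι a) ≤ X.val P m := by
  obtain ⟨n, hn⟩ := Int.eq_ofNat_of_zero_le (P.ord_algebraMap_nonneg a)
  let V : Submodule K A :=
    ((P.filtration n).comap (Algebra.linearMap A (FractionRing A))).restrictScalars K
  obtain ⟨e, heV, he⟩ := X.exists_mem_of_coeff_toLaurent_ne_zero (V := V)
    (fun t b hb => P.algebraMap_map_mem_filtration (hP t) hb)
    ((P.mem_filtration_iff (by simpa using ha0)).mpr hn.ge) hm
  change ι e ∈ P.filtration n at heV
  rwa [he, P.mem_filtration_iff (X.ne_zero m), ← hn] at heV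

theorem val_pos_of_mem (hP : T.Invariant P) (ha : a ∈ P.asIdeal)
    (hm : (X.toLaurent a).coeff m ≠ 0) : 0 < X.val P m := by
  have ha0 : a ≠ 0 := by
    rintro rfl
    simp at hm
  exact ((P.ord_algebraMap_pos_iff ha0).mpr ha).trans_le (X.ord_le_val hP ha0 hm)

theorem exists_val_pos (hP : T.Invariant P) : ∃ m, 0 < X.val P m := by
  obtain ⟨a, ha, ha0⟩ := Submodule.exists_mem_ne_zero_of_ne_bot P.ne_bot
  have hne : X.toLaurent a ≠ 0 := (map_ne_zero_iff _ X.toLaurent_injective).mpr ha0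
  obtain ⟨m, hm⟩ := Finsupp.ne_iff.mp (AddMonoidAlgebra.coeff_eq_zero.not.mpr hne)
  exact ⟨m, X.val_pos_of_mem hP ha hm⟩

theorem exists_val_pos_of_ne (hQ : T.Invariant Q) (h : Q ≠ P) :
    ∃ m ∈ X.regular, X.val P m = 0 ∧ 0 < X.val Q m := by
  by_contra! hcon
  refine h (PrimeDivisor.eq_of_le fun a ha => X.mem_of_forall_val_pos fun m hm => ?_)
  have hreg := X.mem_regular_of_coeff_toLaurent_ne_zero hm
  refine (X.val_nonneg P hreg).lt_of_ne fun h0 => ?_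
  exact (hcon m hreg h0.symm).not_gt (X.val_pos_of_mem hQ ha hm)

theorem exists_forall_val_pos :
    ∃ s ∈ X.regular, ∀ P : PrimeDivisor A, T.Invariant P → 0 < X.val P s := by
  obtain ⟨s, hs, hF⟩ := X.exists_shift
    (Finset.univ.biUnion fun i => {Pi.single i 1, -Pi.single i 1})
  refine ⟨s, hs, fun P hP => (X.val_nonneg P hs).lt_of_ne fun h0 => ?_⟩
  have hzero : X.val P = 0 := by
    refine AddMonoidHom.functions_ext' _ _ _ fun i => AddMonoidHom.ext_int ?_
    have h1 := X.val_nonneg P (hF _ (Finset.mem_biUnion.mpr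
      ⟨i, Finset.mem_univ i, Finset.mem_insert_self (Pi.single i 1) _⟩))
    have h2 := X.val_nonneg P (hF _ (Finset.mem_biUnion.mpr
      ⟨i, Finset.mem_univ i, Finset.mem_insert_of_mem (Finset.mem_singleton_self (-_))⟩))
    rw [map_add, ← h0, add_zero] at h1 h2
    rw [map_neg] at h2
    simpa using by lia
  obtain ⟨m, hm⟩ := X.exists_val_pos hP
  simp [hzero] at hm

theorem finite_invariant (X : T.CharacterSystem) :
    Finite {P : PrimeDivisor A // T.Invariant P} := by
  obtain ⟨s, ⟨a, ha⟩, hs⟩ := X.exists_forall_val_pos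
  exact (PrimeDivisor.finite_setOf_mem (X.ne_zero_of_eq ha)).subset fun P hP =>
    (X.val_pos_iff ha).mp (hs P hP)

theorem exists_val_eq_zero_iff (hP : T.Invariant P) :
    ∃ m ∈ X.regular, ∀ Q, T.Invariant Q → (X.val Q m = 0 ↔ Q = P) := by
  classical
  have := X.finite_invariant
  have := Fintype.ofFinite {P : PrimeDivisor A // T.Invariant P}
  have h : ∀ Q : {Q : PrimeDivisor A // T.Invariant Q}, ∃ m ∈ X.regular, X.val P m = 0 ∧
      (Q.1 ≠ P → 0 < X.val Q m) := by
    intro Q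
    by_cases hQ : Q.1 = P
    · exact ⟨0, zero_mem _, map_zero _, fun h => (h hQ).elim⟩
    · obtain ⟨m, hm, h1, h2⟩ := X.exists_val_pos_of_ne Q.2 hQ
      exact ⟨m, hm, h1, fun _ => h2⟩
  choose m hm h1 h2 using h
  refine ⟨∑ Q, m Q, sum_mem fun Q _ => hm Q, fun Q hQ => ⟨fun h => ?_, ?_⟩⟩
  · by_contra hne
    rw [map_sum] at h
    exact (Finset.sum_pos' (fun Q' _ => X.val_nonneg Q (hm Q'))
      ⟨⟨Q, hQ⟩, Finset.mem_univ _, h2 ⟨Q, hQ⟩ hne⟩).ne' h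
  · rintro rfl
    rw [map_sum]
    exact Finset.sum_eq_zero fun Q' _ => h1 Q'

end Valuation

end TorusAction.CharacterSystem

section InvariantDivisors

variable {K : Type*} [Field K] {r : ℕ} {A : Type*} [CommRing A] [Algebra K A]

namespace TorusAction

/-- The action of the torus on prime divisors by translation. -/
abbrev primeDivisorAction (T : TorusAction K r A) : MulAction (Fin r → Kˣ) (PrimeDivisor A) where
  smul t P :=
    { asIdeal := P.asIdeal.comap (T.act t : A →+* A)
      isPrime := inferInstance
      height_eq := (RingEquiv.height_comap (T.act t).toRingEquiv _).trans P.height_eq }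
  one_smul P := PrimeDivisor.asIdeal_injective <| by
    change P.asIdeal.comap (T.act 1 : A →+* A) = _
    rw [map_one]
    rfl
  mul_smul s t P := PrimeDivisor.asIdeal_injective <| by
    change P.asIdeal.comap (T.act (s * t) : A →+* A) = _
    rw [mul_comm, map_mul]
    rfl

theorem invariant_iff_mem_fixedPoints {T : TorusAction K r A} {P : PrimeDivisor A} :
    T.Invariant P ↔ P ∈ @MulAction.fixedPoints _ _ _ T.primeDivisorAction :=
  let _ := T.primeDivisorAction
  forall_congr' fun t => PrimeDivisor.asIdeal_injective.eq_iff (a := t • P)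

end TorusAction

end InvariantDivisors

namespace TorusAction.CharacterSystem

open AddMonoidAlgebra

variable {K : Type*} [Field K] [IsAlgClosed K] {r : ℕ} {A : Type*} [CommRing A] [IsDomain A]
variable [Algebra K A] [IsNoetherianRing A] [IsIntegrallyClosed A]
variable {T : TorusAction K r A} (X : T.CharacterSystem) {m : Fin r → ℤ} {a : A}
variable {P Q : PrimeDivisor A}

local notation "ι" => algebraMap A (FractionRing A)

theorem invariant_of_val_pos (hm : m ∈ X.regular) (hpos : 0 < X.val P m) : T.Invariant P := by
  let _ := T.primeDivisorAction
  obtain ⟨a, ha⟩ := hm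
  have horbit : MulAction.orbit (Fin r → Kˣ) P ⊆ {Q | a ∈ Q.asIdeal} := by
    rintro _ ⟨t, rfl⟩
    change T.act t a ∈ P.asIdeal
    rw [X.isWeightVector ha t]
    exact Submodule.smul_of_tower_mem _ _ ((X.val_pos_iff ha).mp hpos)
  exact invariant_iff_mem_fixedPoints.mpr <| mem_fixedPoints_of_finite_orbit
    (fun n hn => pow_units_surjective hn)
    ((PrimeDivisor.finite_setOf_mem (X.ne_zero_of_eq ha)).subset horbit)

theorem val_eq_zero (hP : ¬T.Invariant P) (m : Fin r → ℤ) : X.val P m = 0 := by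
  have hzero : ∀ k ∈ X.regular, X.val P k = 0 := fun k hk =>
    (X.val_nonneg P hk).antisymm' (not_lt.mp fun h => hP (X.invariant_of_val_pos hk h))
  obtain ⟨s, hs, hms⟩ := X.exists_shift {m}
  simpa [hzero s hs] using hzero _ (hms m (Finset.mem_singleton_self m))

theorem mem_regular_iff : m ∈ X.regular ↔ ∀ P, T.Invariant P → 0 ≤ X.val P m := by
  refine ⟨fun hm P _ => X.val_nonneg P hm, fun h => mem_range_algebraMap_of_ord_nonneg fun P => ?_⟩
  by_cases hP : T.Invariant P
  · exact h P hP
  · exact (X.val_eq_zero hP m).ge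

theorem ord_ofLaurent_nonneg (hP : ¬T.Invariant P) (p : K[Fin r → ℤ]) :
    0 ≤ P.ord (X.ofLaurent p) := by
  obtain h0 | h0 := eq_or_ne (X.ofLaurent p) 0
  · rw [h0, P.ord_zero]
  · exact (P.mem_filtration_iff h0).mp
      (X.ofLaurent_mem_filtration fun m _ => (X.val_eq_zero hP m).ge)

variable [CharZero K]

theorem ord_ofLaurent_le_of_dvd (hP : ¬T.Invariant P) {p q : K[Fin r → ℤ]} (hq : q ≠ 0)
    (h : p ∣ q) : P.ord (X.ofLaurent p) ≤ P.ord (X.ofLaurent q) := by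
  obtain ⟨d, rfl⟩ := h
  have hne : X.ofLaurent p * X.ofLaurent d ≠ 0 := by
    rwa [← map_mul, map_ne_zero_iff _ X.ofLaurent_injective]
  rw [map_mul, P.ord_mul (left_ne_zero_of_mul hne) (right_ne_zero_of_mul hne)]
  exact le_add_of_nonneg_right (X.ord_ofLaurent_nonneg hP d)

theorem exists_prime_ord_pos (hP : ¬T.Invariant P) {p : K[Fin r → ℤ]}
    (hp : 0 < P.ord (X.ofLaurent p)) : ∃ g, Prime g ∧ 0 < P.ord (X.ofLaurent g) := by
  have := uniqueFactorizationMonoid_addMonoidAlgebra_int (R := K) r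
  induction p using UniqueFactorizationMonoid.induction_on_prime with
  | h₁ => simp [P.ord_zero] at hp
  | h₂ u hu =>
    have h1 := X.ord_ofLaurent_le_of_dvd hP one_ne_zero hu.dvd
    rw [map_one, P.ord_one] at h1
    exact absurd hp h1.not_gt
  | h₃ q g hq hg ih =>
    rw [map_mul, P.ord_mul ((map_ne_zero_iff _ X.ofLaurent_injective).mpr hg.ne_zero)
      ((map_ne_zero_iff _ X.ofLaurent_injective).mpr hq)] at hp
    obtain hpos | hpos := (X.ord_ofLaurent_nonneg hP g).lt_or_eq
    · exact ⟨g, hg, hpos⟩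
    · exact ih (by rwa [← hpos, zero_add] at hp)

theorem comap_span_singleton_eq (hP : ¬T.Invariant P) {g : K[Fin r → ℤ]} (hg : Prime g)
    (hpos : 0 < P.ord (X.ofLaurent g)) : (Ideal.span {g}).comap X.toLaurent = P.asIdeal := by
  have := (Ideal.span_singleton_prime hg.ne_zero).mpr hg
  refine P.eq_asIdeal_of_le ?_ fun a ha => ?_
  · obtain ⟨s, a, ha⟩ := X.exists_toLaurent_eq_mul_single g
    refine (Submodule.ne_bot_iff _).mpr ⟨a, ?_, ?_⟩
    · exact Ideal.mem_span_singleton.mpr ⟨_, ha⟩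
    · rintro rfl
      simp [hg.ne_zero] at ha
  · obtain rfl | ha0 := eq_or_ne a 0
    · exact zero_mem _
    rw [← P.ord_algebraMap_pos_iff ha0, ← X.ofLaurent_toLaurent]
    exact hpos.trans_le (X.ord_ofLaurent_le_of_dvd hP
      ((map_ne_zero_iff _ X.toLaurent_injective).mpr ha0) (Ideal.mem_span_singleton.mp ha))

-- The coordinate ring of the open orbit is a Laurent polynomial ring, hence factorial.
theorem exists_ord_eq_one_of_not_invariant (X : T.CharacterSystem) (hP : ¬T.Invariant P) :
    ∃ f ≠ 0, P.ord f = 1 ∧ ∀ Q, ¬T.Invariant Q → Q ≠ P → Q.ord f = 0 := by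
  obtain ⟨a, haP, ha⟩ := P.exists_ord_eq_one
  obtain ⟨g, hg, hpos⟩ := X.exists_prime_ord_pos hP (p := X.toLaurent a) (by simp [ha])
  have heq := X.comap_span_singleton_eq hP hg hpos
  have ha0 : X.toLaurent a ≠ 0 := by
    rw [map_ne_zero_iff _ X.toLaurent_injective]
    rintro rfl
    simp [P.ord_zero] at ha
  refine ⟨X.ofLaurent g, (map_ne_zero_iff _ X.ofLaurent_injective).mpr hg.ne_zero,
    le_antisymm ?_ hpos, fun Q hQ hQP => ?_⟩
  · rw [← heq] at haP
    simpa [ha] using X.ord_ofLaurent_le_of_dvd hP ha0 (Ideal.mem_span_singleton.mp haP)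
  · refine (X.ord_ofLaurent_nonneg hQ g).antisymm' (not_lt.mp fun h => hQP ?_)
    exact PrimeDivisor.asIdeal_injective ((X.comap_span_singleton_eq hQ hg h).symm.trans heq)

theorem exists_ord_eq_of_not_invariant (X : T.CharacterSystem) (D : WeilDivisor A) :
    ∃ f ≠ 0, ∀ P, ¬T.Invariant P → P.ord f = D P := by
  classical
  induction D using Finsupp.induction_linear with
  | zero => exact ⟨1, one_ne_zero, fun P _ => P.ord_one⟩
  | add D D' hD hD' =>
    obtain ⟨f, hf, hfD⟩ := hD
    obtain ⟨g, hg, hgD⟩ := hD'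
    exact ⟨f * g, mul_ne_zero hf hg, fun P hP => by
      rw [P.ord_mul hf hg, hfD P hP, hgD P hP, Finsupp.add_apply]⟩
  | single P n =>
    by_cases hP : T.Invariant P
    · refine ⟨1, one_ne_zero, fun Q hQ => ?_⟩
      rw [Q.ord_one, Finsupp.single_eq_of_ne (by rintro rfl; exact hQ hP)]
    · obtain ⟨f, hf, hfP, hfQ⟩ := X.exists_ord_eq_one_of_not_invariant hP
      refine ⟨f ^ n, zpow_ne_zero n hf, fun Q hQ => ?_⟩
      obtain rfl | hne := eq_or_ne Q P
      · rw [Q.ord_zpow, hfP, mul_one, Finsupp.single_eq_same]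
      · rw [Q.ord_zpow, hfQ Q hQ hne, mul_zero, Finsupp.single_eq_of_ne hne]

theorem exists_expansion_of_ord_nonneg {f : FractionRing A} (hf : f ≠ 0)
    (h : ∀ P, ¬T.Invariant P → 0 ≤ P.ord f) :
    ∃ p, X.ofLaurent p = f ∧
      ∀ m, p.coeff m ≠ 0 → ∀ P, T.Invariant P → P.ord f ≤ X.val P m := by
  have := X.finite_invariant
  obtain ⟨s, -, hs⟩ := X.exists_forall_val_pos
  obtain ⟨N, hN⟩ := Finite.exists_le
    fun P : {P : PrimeDivisor A // T.Invariant P} => (P.1.ord f).natAbs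
  have hord : ∀ P : PrimeDivisor A, P.ord (f * X.χ (N • s)) = P.ord f + N * X.val P s := fun P => by
    rw [P.ord_mul hf (X.ne_zero _), ← val_apply, map_nsmul, nsmul_eq_mul]
  obtain ⟨a, ha⟩ : ∃ a, ι a = f * X.χ (N • s) := by
    refine mem_range_algebraMap_of_ord_nonneg fun P => ?_
    rw [hord]
    by_cases hP : T.Invariant P
    · have hfN : (P.ord f).natAbs ≤ N := hN ⟨P, hP⟩
      have hmul : (N : ℤ) ≤ N * X.val P s := le_mul_of_one_le_right N.cast_nonneg (hs P hP)
      lia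
    · simpa [X.val_eq_zero hP] using h P hP
  have ha0 : a ≠ 0 := by
    rintro rfl
    simp [hf, X.ne_zero] at ha
  refine ⟨X.toLaurent a * single (-(N • s)) 1, ?_, fun m hm P hP => ?_⟩
  · rw [map_mul, ofLaurent_toLaurent, ofLaurent_single, one_smul, ha, mul_assoc, ← X.add,
      add_neg_cancel, X.χ_zero, mul_one]
  · rw [coeff_mul_single_apply, neg_neg, mul_one] at hm
    have hle := X.ord_le_val hP ha0 hm
    rw [ha, hord, map_add, map_nsmul, nsmul_eq_mul] at hle
    exact le_of_add_le_add_right hle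

theorem exists_eq_smul_of_ord_eq_zero {f : FractionRing A} (hf : f ≠ 0)
    (h : ∀ P, ¬T.Invariant P → P.ord f = 0) : ∃ m, ∃ c : K, c ≠ 0 ∧ f = c • X.χ m := by
  obtain ⟨p, rfl, -⟩ := X.exists_expansion_of_ord_nonneg hf fun P hP => (h P hP).ge
  obtain ⟨q, hq, -⟩ := X.exists_expansion_of_ord_nonneg (inv_ne_zero hf) fun P hP => by
    rw [P.ord_inv, h P hP, neg_zero]
  have hpq : p * q = 1 := X.ofLaurent_injective (by rw [map_mul, hq, mul_inv_cancel₀ hf, map_one])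
  obtain ⟨m, c, hc, rfl⟩ := exists_eq_single_of_isUnit (IsUnit.of_mul_eq_one q hpq)
  exact ⟨m, c, hc, X.ofLaurent_single m c⟩

end TorusAction.CharacterSystem

namespace TorusAction.CharacterSystem

variable {K : Type*} [Field K] {r : ℕ} {A : Type*} [CommRing A] [IsDomain A] [Algebra K A]
variable {T : TorusAction K r A} (X : T.CharacterSystem) {m : Fin r → ℤ} {v : Fin r → ℚ}

local notation "ι" => algebraMap A (FractionRing A)

theorem mem_cone_iff : v ∈ T.cone ↔ ∀ m ∈ X.regular, 0 ≤ (fun i => (m i : ℚ)) ⬝ᵥ v := by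
  constructor
  · rintro h m ⟨a, ha⟩
    exact h ⟨m, a, X.ne_zero_of_eq ha, X.isWeightVector ha, rfl⟩
  · rintro h _ ⟨m, a, ha0, ha, rfl⟩
    exact h m (X.mem_regular_of_isWeightVector ha0 ha)

variable [IsNoetherianRing A] [IsIntegrallyClosed A] {P : PrimeDivisor A}

/-- The linear form `X.val P`, as a vector of `N_ℚ`. -/
def valVec (P : PrimeDivisor A) : Fin r → ℚ := fun i => X.val P (Pi.single i 1)

theorem dotProduct_valVec (P : PrimeDivisor A) (m : Fin r → ℤ) :
    (fun i => (m i : ℚ)) ⬝ᵥ X.valVec P = X.val P m := by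
  conv_rhs => rw [← Finset.univ_sum_single m]
  rw [map_sum, Int.cast_sum, dotProduct]
  refine Finset.sum_congr rfl fun i _ => ?_
  rw [valVec, ← Int.cast_mul, ← smul_eq_mul, ← map_zsmul, ← Pi.single_smul, smul_eq_mul, mul_one]

theorem valVec_mem_cone (P : PrimeDivisor A) : X.valVec P ∈ T.cone := by
  rw [X.mem_cone_iff]
  intro m hm
  rw [dotProduct_valVec]
  exact_mod_cast X.val_nonneg P hm

theorem mem_hull_valVec_iff :
    v ∈ PointedCone.hull ℚ {X.valVec P} ↔ ∃ c : ℚ, 0 ≤ c ∧ v = c • X.valVec P := by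
  rw [Submodule.mem_span_singleton]
  constructor
  · rintro ⟨c, rfl⟩
    exact ⟨c.1, c.2, rfl⟩
  · rintro ⟨c, hc, rfl⟩
    exact ⟨⟨c, hc⟩, rfl⟩

variable [CharZero K]

theorem valVec_ne_zero (hP : T.Invariant P) : X.valVec P ≠ 0 := by
  intro h
  obtain ⟨m, hm⟩ := X.exists_val_pos hP
  have hval := X.dotProduct_valVec P m
  rw [h, dotProduct_zero] at hval
  exact hm.ne (by exact_mod_cast hval)

theorem nonneg_of_smul_valVec_mem_cone (hP : T.Invariant P) {c : ℚ}
    (h : c • X.valVec P ∈ T.cone) : 0 ≤ c := by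
  obtain ⟨m, hm, hpos⟩ := X.exists_forall_val_pos
  have hc := X.mem_cone_iff.mp h m hm
  rw [dotProduct_smul, dotProduct_valVec, smul_eq_mul] at hc
  exact nonneg_of_mul_nonneg_left hc (by exact_mod_cast hpos P hP)

variable [IsAlgClosed K]

theorem cone_eq_hull : T.cone = PointedCone.hull ℚ (X.valVec '' {P | T.Invariant P}) := by
  have hinj : Function.Injective (dotProductBilin ℚ ℚ (m := Fin r) (A := ℚ)).flip := fun v w h =>
    funext fun i => by simpa using LinearMap.congr_fun h (Pi.single i 1)
  have hfin : {P : PrimeDivisor A | T.Invariant P}.Finite := X.finite_invariant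
  rw [← dual_dual_flip_of_finite hinj (hfin.image _)]
  refine le_antisymm (fun v hv => PointedCone.mem_dual.mpr fun {x} hx => ?_)
    (fun v hv => X.mem_cone_iff.mpr fun m hm => hv (PointedCone.mem_dual.mpr ?_))
  · obtain ⟨c, hc, m, hm⟩ := exists_intCast_eq_smul x
    have hreg : m ∈ X.regular := X.mem_regular_iff.mpr fun P hP => by
      have hx' : 0 ≤ x ⬝ᵥ X.valVec P := hx (Set.mem_image_of_mem _ hP)
      rw [← Int.cast_nonneg_iff (R := ℚ), ← X.dotProduct_valVec, hm, smul_dotProduct]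
      exact smul_nonneg hc.le hx'
    have hmv := X.mem_cone_iff.mp hv m hreg
    rw [hm, smul_dotProduct] at hmv
    exact nonneg_of_mul_nonneg_right hmv hc
  · rintro _ ⟨P, -, rfl⟩
    exact X.mem_cone_iff.mp (X.valVec_mem_cone P) m hm

theorem isFaceOf_hull_valVec (hP : T.Invariant P) :
    (PointedCone.hull ℚ {X.valVec P}).IsFaceOf T.cone := by
  obtain ⟨m, hm, hmQ⟩ := X.exists_val_eq_zero_iff hP
  let f : (Fin r → ℚ) →ₗ[ℚ] ℚ := dotProductBilin ℚ ℚ fun i => (m i : ℚ)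
  have hf {v : Fin r → ℚ} (hv : v ∈ T.cone) : 0 ≤ f v := X.mem_cone_iff.mp hv m hm
  have hfval (Q : PrimeDivisor A) : f (X.valVec Q) = X.val Q m := X.dotProduct_valVec Q m
  refine ⟨?_, fun {x y a} hx hy ha h => ?_⟩
  · rw [PointedCone.hull, Submodule.span_singleton_le_iff_mem]
    exact X.valVec_mem_cone P
  obtain ⟨c, -, hc⟩ := X.mem_hull_valVec_iff.mp h
  have hx0 : f x = 0 := by
    have hsum := congrArg f hc
    rw [map_add, map_smul, map_smul, hfval, (hmQ P hP).mpr rfl, Int.cast_zero, smul_zero,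
      smul_eq_mul] at hsum
    exact le_antisymm (nonpos_of_mul_nonpos_right (by linarith [hf hy]) ha) (hf hx)
  rw [X.cone_eq_hull] at hx
  refine Submodule.span_mono ?_ (mem_hull_setOf_eq_zero (f := f) ?_ hx hx0)
  · rintro _ ⟨⟨Q, hQ, rfl⟩, hQ0⟩
    rw [hfval, Int.cast_eq_zero, hmQ Q hQ] at hQ0
    rw [hQ0, Set.mem_singleton_iff]
  · rintro _ ⟨Q, -, rfl⟩
    exact hf (X.valVec_mem_cone Q)

theorem exists_hull_valVec_eq {ρ : PointedCone ℚ (Fin r → ℚ)} (hface : ρ.IsFaceOf T.cone)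
    (hdim : Module.finrank ℚ (Submodule.span ℚ (ρ : Set (Fin r → ℚ))) = 1) :
    ∃ P, T.Invariant P ∧ PointedCone.hull ℚ {X.valVec P} = ρ := by
  obtain ⟨v, hv, hv0⟩ : ∃ v ∈ ρ, v ≠ 0 := by
    by_contra! h
    rw [(Submodule.span_eq_bot (R := ℚ) (s := (ρ : Set (Fin r → ℚ)))).mpr h, finrank_bot] at hdim
    exact zero_ne_one hdim
  obtain ⟨_, ⟨P, hP, rfl⟩, hPρ, -⟩ :=
    exists_ne_zero_mem_of_isFaceOf_hull (X.cone_eq_hull ▸ hface) hv hv0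
  refine ⟨P, hP, le_antisymm ?_ fun w hw => X.mem_hull_valVec_iff.mpr ?_⟩
  · rw [PointedCone.hull, Submodule.span_singleton_le_iff_mem]
    exact hPρ
  have hspan : Submodule.span ℚ {X.valVec P} = Submodule.span ℚ (ρ : Set (Fin r → ℚ)) :=
    Submodule.eq_of_le_of_finrank_eq (Submodule.span_mono (Set.singleton_subset_iff.mpr hPρ))
      (by rw [finrank_span_singleton (X.valVec_ne_zero hP), hdim])
  have hw' : w ∈ Submodule.span ℚ {X.valVec P} := hspan ▸ Submodule.subset_span hw
  obtain ⟨c, rfl⟩ := Submodule.mem_span_singleton.mp hw'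
  exact ⟨c, X.nonneg_of_smul_valVec_mem_cone hP (hface.le hw), rfl⟩

/-- The ray spanned by the valuation of an invariant prime divisor. -/
def ray (P : {P : PrimeDivisor A // T.Invariant P}) : T.Ray :=
  ⟨PointedCone.hull ℚ {X.valVec P.1}, X.isFaceOf_hull_valVec P.2, by
    rw [PointedCone.hull, Submodule.span_span_of_tower, finrank_span_singleton
      (X.valVec_ne_zero P.2)]⟩

theorem rayIdeal_ray (P : {P : PrimeDivisor A // T.Invariant P}) :
    T.rayIdeal (X.ray P) = P.1.asIdeal := by
  refine le_antisymm (Ideal.span_le.mpr ?_) fun a ha => ?_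
  · rintro a ⟨m, ha, v, hv, hpos⟩
    obtain ⟨c, hc, rfl⟩ := X.mem_hull_valVec_iff.mp hv
    rw [dotProduct_smul, dotProduct_valVec, smul_eq_mul] at hpos
    have hval : 0 < X.val P.1 m := by exact_mod_cast pos_of_mul_pos_right hpos hc
    obtain ⟨d, hd⟩ := X.exists_eq_smul ha
    refine X.mem_of_forall_val_pos fun n hn => ?_
    rw [X.toLaurent_eq_iff.mpr (hd.trans (X.ofLaurent_single m d).symm)] at hn
    rwa [of_not_not fun h => hn (Finsupp.single_eq_of_ne h)]
  · choose! e he using fun m => X.mem_regular_of_coeff_toLaurent_ne_zero (a := a) (m := m)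
    have hexpand : a = ∑ m ∈ (X.toLaurent a).coeff.support, (X.toLaurent a).coeff m • e m := by
      apply IsFractionRing.injective A (FractionRing A)
      rw [X.algebraMap_sum_smul (s := 0) fun m hm => ?_, X.ofLaurent_toLaurent, X.χ_zero, mul_one]
      rw [add_zero, he m (Finsupp.mem_support_iff.mp hm)]
    rw [hexpand]
    refine sum_mem fun m hm => Submodule.smul_of_tower_mem _ _ (Ideal.subset_span ?_)
    have hm0 := Finsupp.mem_support_iff.mp hm
    refine ⟨m, X.isWeightVector (he m hm0), X.valVec P.1, PointedCone.subset_hull rfl, ?_⟩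
    rw [dotProduct_valVec]
    exact_mod_cast X.val_pos_of_mem P.2 ha hm0

theorem ray_bijective : Function.Bijective X.ray := by
  constructor
  · intro P Q h
    refine Subtype.ext (PrimeDivisor.asIdeal_injective ?_)
    beta_reduce
    rw [← X.rayIdeal_ray P, ← X.rayIdeal_ray Q, h]
  · rintro ⟨ρ, hface, hdim⟩
    obtain ⟨P, hP, hPρ⟩ := X.exists_hull_valVec_eq hface hdim
    exact ⟨⟨P, hP⟩, Subtype.ext hPρ⟩

/-- The bijection between the rays of the cone and the invariant prime divisors. -/
def rayEquiv : T.Ray ≃ {P : PrimeDivisor A // T.Invariant P} :=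
  (Equiv.ofBijective X.ray X.ray_bijective).symm

theorem asIdeal_rayEquiv (ρ : T.Ray) : (X.rayEquiv ρ).1.asIdeal = T.rayIdeal ρ := by
  obtain ⟨P, rfl⟩ := X.ray_bijective.surjective ρ
  have h : X.rayEquiv (X.ray P) = P := Equiv.symm_apply_apply (Equiv.ofBijective X.ray _) P
  rw [X.rayIdeal_ray, h]

end TorusAction.CharacterSystem

/-! ### The class group and the Cox ring -/

open scoped DirectSum

section ClassGroup

variable {A : Type*} [CommRing A] [IsDomain A] [IsNoetherianRing A] [IsIntegrallyClosed A]

theorem mem_H0_iff {K : Type*} [Field K] [Algebra K A] {f : FractionRing A} (hf : f ≠ 0)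
    {E : WeilDivisor A} : f ∈ H0 K E ↔ 0 ≤ divisorOf f + E :=
  ⟨fun h => h hf, fun h _ => h⟩

variable (A) in
/-- The projection of divisors onto the class group, `divisorClass` as a homomorphism. -/
def divisorClassHom : WeilDivisor A →+ DivisorClassGroup A := QuotientAddGroup.mk' _

@[simp]
theorem divisorClassHom_apply (D : WeilDivisor A) : divisorClassHom A D = divisorClass D := rfl

theorem divisorClass_surjective : Function.Surjective (divisorClass (A := A)) :=
  QuotientAddGroup.mk_surjective

end ClassGroup

namespace ClassGroupSplitting

variable {A : Type*} [CommRing A] [IsDomain A] [IsNoetherianRing A] [IsIntegrallyClosed A]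

theorem nonempty_of_fg [AddGroup.FG (DivisorClassGroup A)] : Nonempty (ClassGroupSplitting A) := by
  classical
  obtain ⟨n, κ, _, p, hp, e, ⟨f⟩⟩ :=
    AddCommGroup.equiv_free_prod_directSum_zmod (DivisorClassGroup A)
  let σ := (Fintype.equivFin κ).symm
  let k : Fin (Fintype.card κ) → ℕ := fun j => p (σ j) ^ e (σ j)
  let torsion : ((j : Fin (Fintype.card κ)) → ZMod (k j)) ≃+ ⨁ i : κ, ZMod (p i ^ e i) :=
    (RingEquiv.piCongrLeft (fun i => ZMod (p i ^ e i)) σ).toAddEquiv.trans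
      (DirectSum.addEquivProd fun i => ZMod (p i ^ e i)).symm
  let g : ((Fin n → ℤ) × ((j : Fin (Fintype.card κ)) → ZMod (k j))) ≃+ DivisorClassGroup A :=
    ((Finsupp.linearEquivFunOnFinite ℤ ℤ (Fin n)).symm.toAddEquiv.prodCongr torsion).trans f.symm
  choose E hE using fun i => divisorClass_surjective (g (Pi.single i 1, 0))
  choose W hW using fun j => divisorClass_surjective (g (0, Pi.single j 1))
  have hF (j) : ∃ F : FractionRing A, IsDivisorOf F (k j • W j) := by
    have hkW : divisorClassHom A (k j • W j) = 0 := by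
      rw [map_nsmul, divisorClassHom_apply, hW, ← map_nsmul, Prod.smul_mk, smul_zero,
        ← Pi.single_smul, nsmul_eq_mul, ZMod.natCast_self, zero_mul, Pi.single_zero]
      exact map_zero g
    exact (QuotientAddGroup.eq_zero_iff _).mp hkW
  choose F hF using hF
  exact ⟨⟨n, _, k, fun j => ⟨pow_ne_zero _ (hp _).ne_zero⟩, g, E, W, hE, hW, F, hF⟩⟩

variable {𝒮 : ClassGroupSplitting A} {g h : 𝒮.Degree} {D E : WeilDivisor A}

theorem divisorClass_rep (g : 𝒮.Degree) : divisorClass (𝒮.rep g) = 𝒮.equiv g := by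
  have hg : g = ∑ i, g.1 i • ((Pi.single i 1, 0) : 𝒮.Degree) +
      ∑ j, (g.2 j).val • ((0, Pi.single j 1) : 𝒮.Degree) := by
    have := 𝒮.k_neZero
    refine Prod.ext ?_ ?_
    · simp [Prod.fst_sum, ← Pi.single_smul, Finset.univ_sum_single]
    · simp only [Prod.snd_add, Prod.snd_sum, Prod.smul_snd, smul_zero, Finset.sum_const_zero,
        zero_add, ← Pi.single_smul]
      simp only [nsmul_eq_mul, mul_one, ZMod.natCast_zmod_val, Finset.univ_sum_single]
  conv_rhs => rw [hg]
  rw [← divisorClassHom_apply, rep]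
  simp only [map_add, map_sum, map_zsmul, map_nsmul, divisorClassHom_apply, 𝒮.class_E, 𝒮.class_W]

variable {K : Type*} [Field K] [Algebra K A] {x y : 𝒮.TotalCoordinateRing K}

variable (K 𝒮) in
/-- `x` is a homogeneous element of degree `g` of the total coordinate ring, given by a nonzero
section of the divisor `rep g` whose divisor of zeros is `D`. -/
def IsSection (x : 𝒮.TotalCoordinateRing K) (g : 𝒮.Degree) (D : WeilDivisor A) : Prop :=
  ∃ f : 𝒮.Component K g, x = DirectSum.of (𝒮.Component K) g f ∧ f.1 ≠ 0 ∧
    divisorOf f.1 + 𝒮.rep g = D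

namespace IsSection

theorem one : 𝒮.IsSection K 1 0 0 := by
  have h1 : (𝒮.const K 1).1 = 1 := map_one (algebraMap K (FractionRing A))
  refine ⟨𝒮.const K 1, rfl, h1 ▸ one_ne_zero, Finsupp.ext fun P => ?_⟩
  rw [h1, 𝒮.rep_zero, add_zero, divisorOf_apply, P.ord_one, Finsupp.zero_apply]

theorem mul (hx : 𝒮.IsSection K x g D) (hy : 𝒮.IsSection K y h E) :
    𝒮.IsSection K (x * y) (g + h) (D + E) := by
  obtain ⟨a, rfl, ha0, rfl⟩ := hx
  obtain ⟨b, rfl, hb0, rfl⟩ := hy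
  have hab0 := mul_ne_zero ha0 hb0
  have hc0 := 𝒮.correction_ne_zero g h
  refine ⟨GradedMonoid.GMul.mul a b, DirectSum.of_mul_of _ _, mul_ne_zero hab0 hc0,
    Finsupp.ext fun P => ?_⟩
  change P.ord (a.1 * b.1 * 𝒮.correction g h) + _ = P.ord a.1 + _ + (P.ord b.1 + _)
  rw [P.ord_mul hab0 hc0, P.ord_mul ha0 hb0, add_assoc, 𝒮.ord_correction]
  ring

theorem pow (hx : 𝒮.IsSection K x g D) (n : ℕ) : 𝒮.IsSection K (x ^ n) (n • g) (n • D) := by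
  induction n with
  | zero => simpa using one
  | succ n ih => simpa only [pow_succ, succ_nsmul] using ih.mul hx

theorem prod {κ : Type*} (s : Finset κ) {x : κ → 𝒮.TotalCoordinateRing K} {g : κ → 𝒮.Degree}
    {D : κ → WeilDivisor A} (hx : ∀ i ∈ s, 𝒮.IsSection K (x i) (g i) (D i)) :
    𝒮.IsSection K (∏ i ∈ s, x i) (∑ i ∈ s, g i) (∑ i ∈ s, D i) := by
  induction s using Finset.cons_induction with
  | empty => simpa using one
  | cons i s hi ih =>
    rw [Finset.prod_cons, Finset.sum_cons, Finset.sum_cons]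
    exact (hx i (Finset.mem_cons_self i s)).mul (ih fun j hj => hx j (Finset.mem_cons_of_mem hj))

theorem coe_apply_ne_zero (hx : 𝒮.IsSection K x g D) : (x g : FractionRing A) ≠ 0 := by
  obtain ⟨f, rfl, hf, -⟩ := hx
  rwa [DirectSum.of_eq_same]

theorem divisorOf_coe_apply (hx : 𝒮.IsSection K x g D) :
    divisorOf (x g : FractionRing A) + 𝒮.rep g = D := by
  obtain ⟨f, rfl, -, hf⟩ := hx
  rwa [DirectSum.of_eq_same]

theorem apply_eq_zero_of_ne (hx : 𝒮.IsSection K x g D) (hgh : g ≠ h) : x h = 0 := by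
  obtain ⟨f, rfl, -, -⟩ := hx
  exact DirectSum.of_eq_of_ne _ _ _ hgh.symm

end IsSection

theorem exists_isSection (hD : 0 ≤ D) (h : divisorClass D = 𝒮.equiv g) :
    ∃ x, 𝒮.IsSection K x g D := by
  rw [← divisorClass_rep, divisorClass_eq_iff] at h
  obtain ⟨f, hf, hfD⟩ := h
  have hdiv : divisorOf f + 𝒮.rep g = D := by rw [hfD, sub_add_cancel]
  exact ⟨_, ⟨f, (mem_H0_iff hf).mpr (hdiv ▸ hD)⟩, rfl, hf, hdiv⟩

end ClassGroupSplitting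

namespace TorusAction

section InvariantDivisors

variable {K : Type*} [Field K] {r : ℕ} {A : Type*} [CommRing A] [Algebra K A]

/-- The group of torus-invariant divisors, i.e. of those supported on invariant prime divisors. -/
def invariantDivisors (T : TorusAction K r A) : AddSubgroup (WeilDivisor A) where
  carrier := {E | ∀ P, ¬T.Invariant P → E P = 0}
  zero_mem' _ _ := rfl
  add_mem' hD hE P hP := by rw [Finsupp.add_apply, hD P hP, hE P hP, add_zero]
  neg_mem' hE P hP := by rw [Finsupp.neg_apply, hE P hP, neg_zero]

variable {T : TorusAction K r A} {R : Type*} (D : R ≃ {P : PrimeDivisor A // T.Invariant P})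

/-- The effective invariant divisor `∑ c ρ • D ρ` of the monomial `∏ x_ρ ^ c ρ`. -/
def monomialDivisor : (R →₀ ℕ) →+ WeilDivisor A :=
  Finsupp.weight fun ρ => Finsupp.single (D ρ).1 1

theorem monomialDivisor_mem_invariantDivisors (c : R →₀ ℕ) :
    monomialDivisor D c ∈ T.invariantDivisors := by
  intro P hP
  rw [monomialDivisor, Finsupp.weight_apply, Finsupp.sum, Finsupp.finsetSum_apply]
  refine Finset.sum_eq_zero fun ρ _ => ?_
  rw [Finsupp.smul_apply, Finsupp.single_eq_of_ne, smul_zero]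
  rintro rfl
  exact hP (D ρ).2

@[simp]
theorem monomialDivisor_apply (c : R →₀ ℕ) (ρ : R) : monomialDivisor D c (D ρ).1 = c ρ := by
  rw [monomialDivisor, Finsupp.weight_apply, Finsupp.sum_apply, Finsupp.sum_eq_single ρ]
  · rw [Finsupp.smul_apply, Finsupp.single_eq_same, nsmul_eq_mul, mul_one]
  · intro ρ' _ hne
    rw [Finsupp.smul_apply, Finsupp.single_eq_of_ne, smul_zero]
    exact fun h => hne (D.injective (Subtype.ext h)).symm
  · rw [zero_smul]
    exact fun _ => rfl

theorem monomialDivisor_injective : Function.Injective (monomialDivisor D) := fun c d h =>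
  Finsupp.ext fun ρ => by simpa using DFunLike.congr_fun h (D ρ).1

theorem exists_monomialDivisor_eq {E : WeilDivisor A} (hE : E ∈ T.invariantDivisors)
    (hE0 : 0 ≤ E) : ∃ c, monomialDivisor D c = E := by
  refine ⟨(E.comapDomain (fun ρ => (D ρ).1) (Subtype.val_injective.comp D.injective).injOn).mapRange
    Int.toNat rfl, Finsupp.ext fun P => ?_⟩
  by_cases hP : T.Invariant P
  · obtain ⟨ρ, hρ⟩ := D.surjective ⟨P, hP⟩
    obtain rfl : (D ρ).1 = P := congrArg Subtype.val hρ
    rw [monomialDivisor_apply, Finsupp.mapRange_apply, Finsupp.comapDomain_apply,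
      Int.toNat_of_nonneg (hE0 _)]
  · rw [monomialDivisor_mem_invariantDivisors D _ P hP, hE P hP]

variable [IsDomain A] [IsNoetherianRing A] [IsIntegrallyClosed A]

theorem divisorClass_monomialDivisor (c : R →₀ ℕ) : divisorClass (monomialDivisor D c) =
    Finsupp.weight (fun ρ => divisorClass (Finsupp.single (D ρ).1 1)) c := by
  simp only [← divisorClassHom_apply, monomialDivisor, Finsupp.weight_apply, map_finsuppSum,
    map_nsmul]

end InvariantDivisors

namespace CharacterSystem

variable {K : Type*} [Field K] [IsAlgClosed K] [CharZero K] {r : ℕ} {A : Type*} [CommRing A]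
variable [IsDomain A] [Algebra K A] [IsNoetherianRing A] [IsIntegrallyClosed A]
variable {T : TorusAction K r A} (X : T.CharacterSystem)

include X

theorem exists_mem_invariantDivisors (E : WeilDivisor A) :
    ∃ E' ∈ T.invariantDivisors, divisorClass E' = divisorClass E := by
  obtain ⟨f, hf, hfE⟩ := X.exists_ord_eq_of_not_invariant E
  refine ⟨E - divisorOf f, fun P hP => ?_, Eq.symm ?_⟩
  · rw [Finsupp.sub_apply, divisorOf_apply, hfE P hP, sub_self]
  · exact divisorClass_eq_iff.mpr ⟨f, hf, (sub_sub_cancel _ _).symm⟩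

theorem fg_divisorClassGroup : AddGroup.FG (DivisorClassGroup A) := by
  have := X.finite_invariant
  let S := (fun P => divisorClass (Finsupp.single P (1 : ℤ))) '' {P | T.Invariant P}
  refine AddGroup.fg_iff.mpr ⟨S, eq_top_iff.mpr fun α _ => ?_, Set.Finite.image _ this⟩
  obtain ⟨E, rfl⟩ := divisorClass_surjective α
  obtain ⟨E', hE', hclass⟩ := X.exists_mem_invariantDivisors E
  rw [← hclass, ← E'.sum_single, ← divisorClassHom_apply, map_finsuppSum]
  refine sum_mem fun P hP => ?_
  beta_reduce
  have hPinv : T.Invariant P := by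
    by_contra h
    exact Finsupp.mem_support_iff.mp hP (hE' P h)
  rw [← Finsupp.smul_single_one, map_zsmul]
  exact zsmul_mem (AddSubgroup.subset_closure (Set.mem_image_of_mem _ hPinv)) _

theorem H0_le_span (E : WeilDivisor A) : H0 K E ≤ Submodule.span K
    {f | f ≠ 0 ∧ 0 ≤ divisorOf f + E ∧ divisorOf f + E ∈ T.invariantDivisors} := by
  intro f hfE
  rcases eq_or_ne f 0 with rfl | hf
  · exact zero_mem _
  obtain ⟨h, hh, hhE⟩ := X.exists_ord_eq_of_not_invariant E
  have hfh (P : PrimeDivisor A) : P.ord (f * h) = P.ord f + P.ord h := P.ord_mul hf hh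
  obtain ⟨p, hp, hpm⟩ := X.exists_expansion_of_ord_nonneg (mul_ne_zero hf hh) fun P hP => by
    rw [hfh, hhE P hP]
    exact hfE hf P
  have hsum : f = ∑ m ∈ p.coeff.support, p.coeff m • (X.χ m / h) := by
    rw [eq_div_of_mul_eq hh hp.symm, X.ofLaurent_apply, Finset.sum_div]
    simp only [smul_div_assoc]
  rw [hsum]
  refine Submodule.sum_mem _ fun m hm => Submodule.smul_mem _ _ (Submodule.subset_span ?_)
  have hord (P : PrimeDivisor A) : (divisorOf (X.χ m / h) + E) P = X.val P m - P.ord h + E P := by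
    rw [Finsupp.add_apply, divisorOf_apply, P.ord_div (X.ne_zero m) hh, X.val_apply]
  have hinv : divisorOf (X.χ m / h) + E ∈ T.invariantDivisors := fun P hP => by
    rw [hord, X.val_eq_zero hP, hhE P hP, zero_sub, neg_add_cancel]
  refine ⟨div_ne_zero (X.ne_zero m) hh, fun P => ?_, hinv⟩
  by_cases hP : T.Invariant P
  · have hle := hpm m (Finsupp.mem_support_iff.mp hm) P hP
    have hfP := hfE hf P
    rw [hfh] at hle
    rw [hord, Finsupp.zero_apply]
    linarith
  · exact (hinv P hP).ge

theorem linearIndependent_of_injective_divisorOf {κ : Type*} {f : κ → FractionRing A}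
    (hf : ∀ i, f i ≠ 0) (hinv : ∀ i j, divisorOf (f i) - divisorOf (f j) ∈ T.invariantDivisors)
    (hinj : Function.Injective fun i => divisorOf (f i)) : LinearIndependent K f := by
  rcases isEmpty_or_nonempty κ with _ | ⟨⟨i₀⟩⟩
  · exact linearIndependent_empty_type
  have hχ (i) : ∃ m, ∃ c : K, c ≠ 0 ∧ f i / f i₀ = c • X.χ m := by
    refine X.exists_eq_smul_of_ord_eq_zero (div_ne_zero (hf i) (hf i₀)) fun P hP => ?_
    rw [P.ord_div (hf i) (hf i₀)]
    exact hinv i i₀ P hP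
  choose m c hc hfm using hχ
  have hfm' (i) : f i = c i • (f i₀ * X.χ (m i)) := by
    rw [← mul_smul_comm, ← hfm, mul_div_cancel₀ _ (hf i₀)]
  have hm : Function.Injective m := fun i j hij => hinj <| Finsupp.ext fun P => by
    rw [divisorOf_apply, divisorOf_apply, hfm' i, hfm' j, hij, P.ord_smul (hc i),
      P.ord_smul (hc j)]
  have hmul : LinearIndependent K fun i => f i₀ * X.χ (m i) :=
    (X.linearIndependent_χ.comp m hm).map' (LinearMap.mulLeft K (f i₀))
      (LinearMap.ker_eq_bot.mpr (mul_right_injective₀ (hf i₀)))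
  rw [funext hfm']
  exact hmul.units_smul fun i => Units.mk0 (c i) (hc i)

end CharacterSystem

end TorusAction

namespace TorusAction

section CoxHom

variable {K : Type*} [Field K] {r : ℕ} {A : Type*} [CommRing A] [IsDomain A] [Algebra K A]
variable [IsNoetherianRing A] [IsIntegrallyClosed A] {T : TorusAction K r A} {R : Type*}
variable (D : R ≃ {P : PrimeDivisor A // T.Invariant P}) (𝒮 : ClassGroupSplitting A)

theorem exists_isSection_single (ρ : R) : ∃ x : 𝒮.TotalCoordinateRing K,
    𝒮.IsSection K x (𝒮.equiv.symm (divisorClass (Finsupp.single (D ρ).1 1)))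
      (Finsupp.single (D ρ).1 1) :=
  ClassGroupSplitting.exists_isSection (Finsupp.single_nonneg.mpr zero_le_one)
    (𝒮.equiv.apply_symm_apply _).symm

/-- The homomorphism from the Cox ring to the total coordinate ring which sends `x_ρ` to a section
with divisor of zeros `D ρ`. -/
def coxHom : MvPolynomial R K →ₐ[K] 𝒮.TotalCoordinateRing K :=
  MvPolynomial.aeval fun ρ => (exists_isSection_single D 𝒮 ρ).choose

variable {D 𝒮} in
theorem isSection_coxHom_monomial {c : R →₀ ℕ} {g : 𝒮.Degree}
    (hg : divisorClass (monomialDivisor D c) = 𝒮.equiv g) :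
    𝒮.IsSection K (coxHom D 𝒮 (MvPolynomial.monomial c 1)) g (monomialDivisor D c) := by
  have hx (ρ : R) := (exists_isSection_single (K := K) D 𝒮 ρ).choose_spec
  have hprod : coxHom (K := K) D 𝒮 (MvPolynomial.monomial c 1) =
      ∏ ρ ∈ c.support, (exists_isSection_single D 𝒮 ρ).choose ^ c ρ := by
    rw [coxHom, MvPolynomial.aeval_monomial, map_one]
    exact one_mul (M := 𝒮.TotalCoordinateRing K) _
  have hsum : g = ∑ ρ ∈ c.support,
      c ρ • 𝒮.equiv.symm (divisorClass (Finsupp.single (D ρ).1 1)) := by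
    rw [← 𝒮.equiv.symm_apply_apply g, ← hg, divisorClass_monomialDivisor, Finsupp.weight_apply,
      map_finsuppSum]
    simp only [map_nsmul, Finsupp.sum]
  rw [hprod, hsum]
  exact .prod _ fun ρ _ => (hx ρ).pow (c ρ)

end CoxHom

namespace CharacterSystem

variable {K : Type*} [Field K] [IsAlgClosed K] [CharZero K] {r : ℕ} {A : Type*} [CommRing A]
variable [IsDomain A] [Algebra K A] [IsNoetherianRing A] [IsIntegrallyClosed A]
variable {T : TorusAction K r A} (X : T.CharacterSystem) {R : Type*}
variable (D : R ≃ {P : PrimeDivisor A // T.Invariant P}) (𝒮 : ClassGroupSplitting A)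

include X

theorem coxHom_injective : Function.Injective (coxHom (K := K) D 𝒮) := by
  let deg (c : R →₀ ℕ) : 𝒮.Degree := 𝒮.equiv.symm (divisorClass (monomialDivisor D c))
  let π (g : 𝒮.Degree) : MvPolynomial R K →ₗ[K] FractionRing A :=
    (H0 K (𝒮.rep g)).subtype ∘ₗ DirectSum.component K 𝒮.Degree (𝒮.Component K) g ∘ₗ
      (coxHom D 𝒮).toLinearMap
  have hx {g} (c) (hc : deg c = g) : 𝒮.IsSection K (coxHom D 𝒮 (MvPolynomial.monomial c 1)) g
      (monomialDivisor D c) :=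
    isSection_coxHom_monomial (𝒮.equiv.symm_apply_eq.mp hc)
  refine (injective_iff_map_eq_zero _).mpr fun p hp =>
    eq_zero_of_forall_linearIndependent_fiber (MvPolynomial.basisMonomials R K) deg π
      (fun g c hc => ?_) (fun g => ?_) fun g => ?_
  · exact congrArg Subtype.val ((hx c rfl).apply_eq_zero_of_ne hc)
  · have hdiv (c : {c // deg c = g}) : divisorOf (π g (MvPolynomial.basisMonomials R K c.1)) =
        monomialDivisor D c.1 - 𝒮.rep g :=
      eq_sub_of_add_eq (hx c.1 c.2).divisorOf_coe_apply
    refine X.linearIndependent_of_injective_divisorOf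
      (fun c => (hx c.1 c.2).coe_apply_ne_zero) (fun c d => ?_) fun c d hcd => ?_
    · rw [hdiv, hdiv, sub_sub_sub_cancel_right]
      exact sub_mem (monomialDivisor_mem_invariantDivisors D c.1)
        (monomialDivisor_mem_invariantDivisors D d.1)
    · beta_reduce at hcd
      rw [hdiv, hdiv, sub_left_inj] at hcd
      exact Subtype.ext (monomialDivisor_injective D hcd)
  · exact congrArg (fun x : 𝒮.TotalCoordinateRing K => (x g : FractionRing A)) hp

variable (hunits : ∀ u : A, IsUnit u → ∃ c : K, algebraMap K A c = u)

include hunits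

theorem map_coxHom_weightedHomogeneousSubmodule (g : 𝒮.Degree) :
    (MvPolynomial.weightedHomogeneousSubmodule K
        (fun ρ => divisorClass (Finsupp.single (D ρ).1 1)) (𝒮.equiv g)).map
      (coxHom D 𝒮).toLinearMap = LinearMap.range (DirectSum.lof K _ (𝒮.Component K) g) := by
  refine le_antisymm ?_ ?_
  · rw [MvPolynomial.weightedHomogeneousSubmodule_eq_finsupp_supported,
      AddMonoidAlgebra.supported_eq_span_single, Submodule.map_le_iff_le_comap, Submodule.span_le]
    rintro _ ⟨c, hc, rfl⟩
    obtain ⟨f, hf, -⟩ :=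
      isSection_coxHom_monomial (K := K) ((divisorClass_monomialDivisor D c).trans hc)
    exact ⟨f, hf.symm⟩
  · rintro _ ⟨f, rfl⟩
    let V := ((MvPolynomial.weightedHomogeneousSubmodule K
      (fun ρ => divisorClass (Finsupp.single (D ρ).1 1)) (𝒮.equiv g)).map
        (coxHom D 𝒮).toLinearMap).comap (DirectSum.lof K _ (𝒮.Component K) g)
    suffices H0 K (𝒮.rep g) ≤ V.map (H0 K (𝒮.rep g)).subtype by
      obtain ⟨f', hf', heq⟩ := this f.2
      exact Subtype.ext heq ▸ hf'
    refine (X.H0_le_span _).trans (Submodule.span_le.mpr ?_)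
    rintro f ⟨hf, hf0, hinv⟩
    obtain ⟨c, hc⟩ := exists_monomialDivisor_eq D hinv hf0
    have hg : divisorClass (monomialDivisor D c) = 𝒮.equiv g := by
      rw [hc, ← ClassGroupSplitting.divisorClass_rep, divisorClass_eq_iff]
      exact ⟨f, hf, (add_sub_cancel_right _ _).symm⟩
    obtain ⟨f', hf', hf'0, hdiv⟩ := isSection_coxHom_monomial (K := K) hg
    have hff' : divisorOf f = divisorOf f'.1 := add_right_cancel (hc.symm.trans hdiv.symm)
    obtain ⟨a, rfl⟩ := exists_eq_smul_of_ord_eq hunits hf hf'0 (DFunLike.congr_fun hff')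
    have hmem : f' ∈ V := ⟨MvPolynomial.monomial c 1, MvPolynomial.isWeightedHomogeneous_monomial
      _ _ _ ((divisorClass_monomialDivisor D c).symm.trans hg), hf'⟩
    exact Submodule.smul_mem _ _ ⟨f', hmem, rfl⟩

theorem exists_coxEquiv : ∃ φ : 𝒮.TotalCoordinateRing K ≃ₐ[K] MvPolynomial R K,
    ∀ g : 𝒮.Degree, (LinearMap.range (DirectSum.lof K 𝒮.Degree (𝒮.Component K) g)).map
      φ.toLinearMap = MvPolynomial.weightedHomogeneousSubmodule K
        (fun ρ => divisorClass (Finsupp.single (D ρ).1 1)) (𝒮.equiv g) := by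
  have hmap := X.map_coxHom_weightedHomogeneousSubmodule D 𝒮 hunits
  have hsurj : LinearMap.range (coxHom (K := K) D 𝒮).toLinearMap = ⊤ := by
    refine eq_top_iff.mpr ((DFinsupp.iSup_range_lsingle).ge.trans (iSup_le fun g => ?_))
    exact (hmap g).symm.trans_le LinearMap.map_le_range
  let ψ := AlgEquiv.ofBijective (coxHom D 𝒮)
    ⟨X.coxHom_injective D 𝒮, LinearMap.range_eq_top.mp hsurj⟩
  refine ⟨ψ.symm, fun g => ?_⟩
  rw [← hmap]
  exact Submodule.map_symm_eq_iff ψ.toLinearEquiv |>.mpr rfl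

end CharacterSystem

end TorusAction

end

theorem lemma6 {K : Type*} [Field K] [IsAlgClosed K] [CharZero K]
    {A : Type*} [CommRing A] [IsDomain A] [Algebra K A] [Algebra.FiniteType K A]
    [IsNoetherianRing A] [IsIntegrallyClosed A]
    {r : ℕ} (T : TorusAction K r A) (hT : T.LocallyTransitive) (hTeff : T.Effective)
    (hunits : ∀ u : A, IsUnit u → ∃ c : K, algebraMap K A c = u) :
    ∃ D : T.Ray ≃ {P : PrimeDivisor A // T.Invariant P},
      (∀ ρ, (D ρ).1.asIdeal = T.rayIdeal ρ) ∧
      Finite T.Ray ∧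
      Nonempty (ClassGroupSplitting A) ∧
      ∀ 𝒮 : ClassGroupSplitting A,
        ∃ φ : 𝒮.TotalCoordinateRing K ≃ₐ[K] MvPolynomial T.Ray K,
          ∀ g : 𝒮.Degree,
            (LinearMap.range (DirectSum.lof K 𝒮.Degree (𝒮.Component K) g)).map
                φ.toLinearMap =
              MvPolynomial.weightedHomogeneousSubmodule K
                (fun ρ => divisorClass (Finsupp.single (D ρ).1 1)) (𝒮.equiv g) := by
  obtain ⟨X⟩ := T.nonempty_characterSystem hT hTeff
  have := X.finite_invariant
  have := X.fg_divisorClassGroup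
  exact ⟨X.rayEquiv, X.asIdeal_rayEquiv, .of_equiv _ X.rayEquiv.symm,
    ClassGroupSplitting.nonempty_of_fg, fun 𝒮 => X.exists_coxEquiv X.rayEquiv 𝒮 hunits⟩
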